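/- All Lie algebras are finite-dimensional over $\mathbb{C}$. A Lie algebra $\mathfrak g$ is *complete* if its center is $0$ and all its derivations are inner. A *torus* of a nilpotent Lie algebra $\mathfrak n$ is an abelian subalgebra of $\mathrm{Der}(\mathfrak n)$ consisting of semisimple endomorphisms of $\mathfrak n$; the *rank* of $\mathfrak n$ is the dimension of a maximal torus, and $\mathfrak n$ is *completable* if the semidirect product $\mathfrak n\rtimes\mathfrak t$ is complete, where $\mathfrak t$ is a maximal torus of $\mathfrak n$. For $Y\in\mathfrak n\setminus[\mathfrak n,\mathfrak n]$ let $c(Y)$ be the decreasing sequence of the sizes of the Jordan blocks of $\mathrm{ad}\,Y$; $\mathfrak n$ is *filiform* if it is nilpotent and the lexicographic maximum of the $c(Y)$ is $(\dim\mathfrak n-1,1)$. Given numbers $\lambda_1,\lambda_2,\dots$, let $a_{ij}$ $(2\le i\le j)$ be determined by $a_{ii}=0$, $a_{i,i+1}=\lambda_{i-1}$ and $a_{ij}=a_{i,j+1}+a_{i+1,j}$ for $i<j$. Define Lie algebras with basis $Y_1,\dots,Y_n$ by the following brackets (brackets that are not determined by those listed and skew-symmetry are $0$): * $L_n$: $[Y_1,Y_j]=Y_{j+1}$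 for $2\le j\le n-1$. * $Q_n$, $n=2p$: $[Y_1,Y_j]=Y_{j+1}$ for $2\le j\le n-1$, and $[Y_i,Y_{n-i+1}]=(-1)^{i+1}Y_n$ for $2\le i\le p$. * $A_n^k(\lambda_1,\dots,\lambda_{t-1})$, $2\le k\le n-3$, $t=\lfloor\frac{n-k+1}{2}\rfloor$: $[Y_1,Y_j]=Y_{j+1}$ for $2\le j\le n-1$, and $[Y_i,Y_j]=a_{ij}Y_{i+j+k-2}$ for $2\le i<j$, $i+j+k-2\le n$. * $B_n^k(\lambda_1,\dots,\lambda_{t-1})$, $n$ even, $2\le k\le n-3$, $t=\lfloor\frac{n-k}{2}\rfloor$: $[Y_1,Y_j]=Y_{j+1}$ for $2\le j\le n-2$, $[Y_i,Y_{n-i+1}]=(-1)^{i+1}Y_n$ for $2\le i\le n-1$, and $[Y_i,Y_j]=a_{ij}Y_{i+j+k-2}$ for $2\le i<j$, $i+j+k-2\le n-1$. In the last two families the parameters $\lambda_1,\dots,\lambda_{t-1}\in\mathbb C$ do not all vanish and are such that the Jacobi identity holds (only $\lambda_1,\dots,\lambda_{t-1}$ enter the brackets). **Theorem.** A filiform Lie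 algebra of non-zero rank is completable if and only if it is isomorphic to some $L_n$, $Q_n$, $A_n^k(\lambda_1,\dots,\lambda_{t-1})$ or $B_n^k(\lambda_1,\dots,\lambda_{t-1})$. -/

import Mathlib

namespace CompletableFiliform

open Module

/-! ### Complete Lie algebras, tori, rank, completable Lie algebras -/

/-- A complex Lie algebra is complete if its center is zero and all its derivations are inner,
that is, if `H⁰(g, g) = 0` and `H¹(g, g) = 0`. -/
def IsCompleteLie (g : Type*) [LieRing g] [LieAlgebra ℂ g] : Prop :=
  LieAlgebra.center ℂ g = ⊥ ∧
    ∀ D : LieDerivation ℂ g g, ∃ x : g, ∀ y : g, D y = ⁅x, y⁆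

variable (n : Type*) [LieRing n] [LieAlgebra ℂ n]

/-- A torus of derivations of `n`: an abelian subalgebra of `Der n` consisting of derivations
that are semisimple (over `ℂ`: diagonalizable) endomorphisms of `n`. -/
def IsTorus (t : LieSubalgebra ℂ (LieDerivation ℂ n n)) : Prop :=
  IsLieAbelian t ∧ ∀ D ∈ t, Module.End.IsSemisimple (D : n →ₗ[ℂ] n)

/-- A torus that is maximal for inclusion. -/
def IsMaximalTorus (t : LieSubalgebra ℂ (LieDerivation ℂ n n)) : Prop :=
  Maximal (IsTorus n) t

/-- The rank: the dimension of a maximal torus of derivations. (All maximal tori have the same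
dimension; the supremum merely selects this common value. In particular the rank is nonzero
exactly when there is a nonzero maximal torus.) -/
noncomputable def rank : ℕ :=
  sSup {r : ℕ | ∃ t : LieSubalgebra ℂ (LieDerivation ℂ n n),
    IsMaximalTorus n t ∧ r = finrank ℂ t}

/-- `n` is completable if `n ⋊ t`, with `t` acting on `n` by evaluation, is a complete Lie
algebra, where `t` is a maximal torus of derivations of `n`. -/
def IsCompletable : Prop :=
  ∃ t : LieSubalgebra ℂ (LieDerivation ℂ n n),
    IsMaximalTorus n t ∧ IsCompleteLie (n ⋊⁅t.incl⁆ t)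

/-! ### Characteristic sequence and filiform Lie algebras -/

/-- `h = (h₁ ≥ h₂ ≥ ⋯ ≥ h_p ≥ 1)` is the sequence of sizes of the Jordan blocks of the nilpotent
endomorphism `f`: there is a basis made of `p` chains `e_{i,0} ↦ e_{i,1} ↦ ⋯ ↦ e_{i,h_i-1} ↦ 0`. -/
structure IsJordanSequence {V : Type*} [AddCommGroup V] [Module ℂ V] (f : End ℂ V)
    (h : List ℕ) : Prop where
  sorted : h.Pairwise (fun a b => b ≤ a)
  pos : ∀ a ∈ h, 0 < a
  exists_basis : ∃ e : Basis (Σ i : Fin h.length, Fin (h.get i)) ℂ V,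
    ∀ (i : Fin h.length) (j : Fin (h.get i)),
      f (e ⟨i, j⟩) = if hj : (j : ℕ) + 1 < h.get i then e ⟨i, ⟨j + 1, hj⟩⟩ else 0

/-- `h` is the characteristic sequence of the nilpotent Lie algebra `n`: the greatest, for the
lexicographic order, of the Jordan sequences of `ad Y`, where `Y` runs over the elements of `n`
outside the derived algebra `[n, n]`. -/
def IsCharacteristicSequence (h : List ℕ) : Prop :=
  IsGreatest {c : List ℕ | ∃ Y : n, Y ∉ LieAlgebra.derivedSeries ℂ n 1 ∧
    IsJordanSequence (LieAlgebra.ad ℂ n Y) c} h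

/-- A nilpotent Lie algebra is filiform if its characteristic sequence is `(dim n - 1, 1)`. -/
def IsFiliform : Prop :=
  LieRing.IsNilpotent n ∧ IsCharacteristicSequence n [finrank ℂ n - 1, 1]

/-! ### The Lie algebras `L_N`, `Q_N`, `A_N^k(λ)`, `B_N^k(λ)`

The vectors of a basis `Y_1, …, Y_N` are indexed by `Fin N`, so that `Y_i` is `Y ⟨i - 1, _⟩`;
structure constants use the indices `1, …, N`. -/

/-- `n` is isomorphic to the `N`-dimensional Lie algebra with brackets
`[Y_i, Y_j] = ∑ l, c i j l • Y_l` for `1 ≤ i < j ≤ N` (the other brackets being given by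
skew-symmetry), i.e. `n` has a basis with this multiplication table. As `n` is a Lie algebra, this
can hold only if the structure constants satisfy the Jacobi conditions. -/
def HasTable (N : ℕ) (c : ℕ → ℕ → ℕ → ℂ) : Prop :=
  ∃ Y : Basis (Fin N) ℂ n, ∀ i j : Fin N, i < j →
    ⁅Y i, Y j⁆ = ∑ l : Fin N, c (i + 1) (j + 1) (l + 1) • Y l

/-- `L_N`: `[Y_1, Y_j] = Y_{j+1}` for `2 ≤ j ≤ N - 1`. -/
def tableL (i j l : ℕ) : ℂ :=
  if i = 1 ∧ l = j + 1 then 1 else 0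

/-- `Q_N`: `[Y_1, Y_j] = Y_{j+1}` for `2 ≤ j ≤ N - 1`, and
`[Y_i, Y_{N-i+1}] = (-1)^(i+1) Y_N` for `2 ≤ i ≤ N / 2`. -/
def tableQ (N i j l : ℕ) : ℂ :=
  if i = 1 then (if l = j + 1 then 1 else 0)
  else if i + j = N + 1 ∧ l = N then (-1) ^ (i + 1) else 0

/-- Auxiliary recursion: `coefGap lam d i` is the coefficient `a_{i,i+d}`. -/
def coefGap (lam : ℕ → ℂ) : ℕ → ℕ → ℂ
  | 0, _ => 0
  | 1, i => lam (i - 1)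
  | d + 2, i => coefGap lam (d + 1) i - coefGap lam d (i + 1)

/-- The coefficients `a_{ij}`, for `i ≤ j`, determined by `a_{ii} = 0`, `a_{i,i+1} = λ_{i-1}` and
`a_{ij} = a_{i,j+1} + a_{i+1,j}`. -/
def coef (lam : ℕ → ℂ) (i j : ℕ) : ℂ := coefGap lam (j - i) i

theorem coef_self (lam : ℕ → ℂ) (i : ℕ) : coef lam i i = 0 := by
  simp [coef, coefGap]

theorem coef_succ (lam : ℕ → ℂ) (i : ℕ) : coef lam i (i + 1) = lam (i - 1) := by
  simp [coef, coefGap]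

theorem coef_rec (lam : ℕ → ℂ) {i j : ℕ} (h : i < j) :
    coef lam i j = coef lam i (j + 1) + coef lam (i + 1) j := by
  obtain ⟨d, rfl⟩ : ∃ d, j = i + 1 + d := ⟨j - (i + 1), by omega⟩
  have h1 : i + 1 + d - i = d + 1 := by omega
  have h2 : i + 1 + d + 1 - i = d + 2 := by omega
  have h3 : i + 1 + d - (i + 1) = d := by omega
  simp [coef, h1, h2, h3, coefGap]

/-- `A_N^k(λ)`: `[Y_1, Y_j] = Y_{j+1}` for `2 ≤ j ≤ N - 1`, and
`[Y_i, Y_j] = a_{ij} Y_{i+j+k-2}` for `2 ≤ i < j`, `i + j + k - 2 ≤ N`. -/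
def tableA (k : ℕ) (lam : ℕ → ℂ) (i j l : ℕ) : ℂ :=
  if i = 1 then (if l = j + 1 then 1 else 0)
  else if l + 2 = i + j + k then coef lam i j else 0

/-- `B_N^k(λ)`: `[Y_1, Y_j] = Y_{j+1}` for `2 ≤ j ≤ N - 2`,
`[Y_i, Y_{N-i+1}] = (-1)^(i+1) Y_N` for `2 ≤ i ≤ N - 1`, and
`[Y_i, Y_j] = a_{ij} Y_{i+j+k-2}` for `2 ≤ i < j`, `i + j + k - 2 ≤ N - 1`. -/
def tableB (N k : ℕ) (lam : ℕ → ℂ) (i j l : ℕ) : ℂ :=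
  if i = 1 then (if l = j + 1 ∧ l < N then 1 else 0)
  else if i + j = N + 1 ∧ l = N then (-1) ^ (i + 1)
  else if l + 2 = i + j + k ∧ l < N then coef lam i j else 0

/-- `n` is isomorphic to `L_N`. -/
def IsoL (N : ℕ) : Prop := HasTable n N tableL

/-- `N` is even and `n` is isomorphic to `Q_N`. -/
def IsoQ (N : ℕ) : Prop := Even N ∧ HasTable n N (tableQ N)

/-- `n` is isomorphic to `A_N^k(λ_1, …, λ_{t-1})`, where `t = ⌊(N - k + 1) / 2⌋`,
`2 ≤ k ≤ N - 3` and the parameters do not all vanish. Only the values of `lam` at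
`1, …, t - 1` enter the multiplication table. -/
def IsoA (N k : ℕ) (lam : ℕ → ℂ) : Prop :=
  2 ≤ k ∧ k + 3 ≤ N ∧ (∃ s, 1 ≤ s ∧ s ≤ (N - k + 1) / 2 - 1 ∧ lam s ≠ 0) ∧
    HasTable n N (tableA k lam)

/-- `n` is isomorphic to `B_N^k(λ_1, …, λ_{t-1})`, where `N` is even, `t = ⌊(N - k) / 2⌋`,
`2 ≤ k ≤ N - 3` and the parameters do not all vanish. Only the values of `lam` at
`1, …, t - 1` enter the multiplication table. -/
def IsoB (N k : ℕ) (lam : ℕ → ℂ) : Prop :=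
  Even N ∧ 2 ≤ k ∧ k + 3 ≤ N ∧ (∃ s, 1 ≤ s ∧ s ≤ (N - k) / 2 - 1 ∧ lam s ≠ 0) ∧
    HasTable n N (tableB N k lam)

end CompletableFiliform

namespace CompletableFiliform

open Module LieAlgebra

/-! Completability comes from a grading. If `D` is a derivation that is diagonal in some basis with
distinct nonzero eigenvalues, its centralizer in the derivation algebra consists of the diagonal
derivations; this is a maximal torus `t`, and `L ⋊ t` is complete (`isCompletable_of_diagonal`). The
tables `A` and `B` carry such a `D`, with distinct positive integral weights. `L_N` is `A` with zero
parameters, and `Q_N` becomes `B` with zero parameters once `Y₁` is replaced by `Y₁ + Y₂`.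

Conversely, a filiform algebra of dimension at least 3 has an adapted basis. Its flag is given by
the lower central series from `F 3` on, and for `i, j ≥ 2` the bracket of `y i` and `y j` falls into
`F (i + j)`, except for a term `(-1)^i c • y N` when `i + j = N + 1` (`IsAdapted.lie_mem_of_add_le`,
`IsAdapted.exists_lie_eq`). For `N ≥ 5` every derivation preserves this flag, so a semisimple one
has eigenvectors `X 1`, `X 2` with eigenvalues `α`, `β` that lift the first two steps. They generate
an eigenbasis whose graded type is that of `L_N` or of `Q_N` (`IsAdapted.exists_eigenbasis`). A
nonzero coefficient of `X l` (`l < N` in type `Q`) in a bracket of `X i` and `X j` forces `β = (l +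
2 - i - j) α`; as the weights do not both vanish, the shift `k = l + 2 - i - j` is the same for all
of them. The Leibniz rule for `ad (X 1)` is the recursion of the `a_ij`. This yields the families.

One case escapes: type `Q` with `α = 0`, where all brackets of `X 2, …, X N` are multiples of `X N`.
If a completable algebra lay outside the families, its torus would be nonzero (otherwise the center
survives), every nonzero element of it would be of this kind, and it would be a line. But then the
cube of `ad (X 1)` gives an outer derivation of `L ⋊ t` (`IsEigenBasisQ.not_isCompleteLie`). -/

theorem isSemisimple_of_diagonal {ι V : Type*} [Fintype ι] [AddCommGroup V] [Module ℂ V]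
    (Y : Basis ι ℂ V) (f : End ℂ V) (w : ι → ℂ) (h : ∀ i, f (Y i) = w i • Y i) :
    f.IsSemisimple := by
  classical
  refine End.isSemisimple_of_squarefree_aeval_eq_zero
    (p := ∏ μ ∈ Finset.univ.image w, (Polynomial.X - Polynomial.C μ)) ?_ ?_
  · exact (Polynomial.separable_prod_X_sub_C_iff'.2 fun _ _ _ _ h => h).squarefree
  · refine Y.ext fun i => ?_
    have hi : w i ∈ Finset.univ.image w := Finset.mem_image_of_mem _ (Finset.mem_univ i)
    rw [← Finset.prod_erase_mul _ _ hi, map_mul]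
    simp [h]

theorem leibniz_of_basis {ι L : Type*} [LinearOrder ι] [LieRing L] [LieAlgebra ℂ L]
    (Y : Basis ι ℂ L) (f : L →ₗ[ℂ] L)
    (h : ∀ i j, i < j → f ⁅Y i, Y j⁆ = ⁅f (Y i), Y j⁆ + ⁅Y i, f (Y j)⁆) (a b : L) :
    f ⁅a, b⁆ = ⁅a, f b⁆ - ⁅b, f a⁆ := by
  have key : ∀ i j, f ⁅Y i, Y j⁆ = ⁅f (Y i), Y j⁆ + ⁅Y i, f (Y j)⁆ := by
    intro i j
    rcases lt_trichotomy i j with hij | rfl | hij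
    · exact h i j hij
    · rw [lie_self, map_zero, ← lie_skew (f (Y i)) (Y i), add_comm, add_neg_cancel]
    · rw [← lie_skew, map_neg, h j i hij, ← lie_skew (f (Y i)), ← lie_skew (Y i)]; abel
  have e : (LieModule.toEnd ℂ L L : L →ₗ[ℂ] End ℂ L).compr₂ f =
      ((LieModule.toEnd ℂ L L : L →ₗ[ℂ] End ℂ L).comp f) +
      (LieModule.toEnd ℂ L L : L →ₗ[ℂ] End ℂ L).compl₂ f :=
    Y.ext fun i => Y.ext fun j => by simpa using key i j
  have := LinearMap.congr_fun₂ e a b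
  simp only [LinearMap.compr₂_apply, LinearMap.add_apply, LinearMap.compl₂_apply,
    LinearMap.comp_apply, LieHom.coe_toLinearMap, LieModule.toEnd_apply_apply] at this
  rw [this, ← lie_skew (f a)]; abel

/-- The derivation given by a linear map that satisfies the Leibniz rule on a basis. -/
def derivationOfBasis {ι L : Type*} [LinearOrder ι] [LieRing L] [LieAlgebra ℂ L]
    (Y : Basis ι ℂ L) (f : L →ₗ[ℂ] L)
    (h : ∀ i j, i < j → f ⁅Y i, Y j⁆ = ⁅f (Y i), Y j⁆ + ⁅Y i, f (Y j)⁆) : LieDerivation ℂ L L :=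
  { f with leibniz' := leibniz_of_basis Y f h }

/-- Weights that add up along every nonzero structure constant grade the algebra, and the degree map
of a grading is a derivation. -/
theorem exists_diagonal_derivation {L : Type*} [LieRing L] [LieAlgebra ℂ L] {N : ℕ}
    {c : ℕ → ℕ → ℕ → ℂ} (Y : Basis (Fin N) ℂ L)
    (hY : ∀ i j : Fin N, i < j → ⁅Y i, Y j⁆ = ∑ l : Fin N, c (i + 1) (j + 1) (l + 1) • Y l)
    (w : ℕ → ℂ) (hw : ∀ i j l : ℕ, 1 ≤ i → i < j → 1 ≤ l → l ≤ N → c i j l ≠ 0 →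
      w l = w i + w j) :
    ∃ D : LieDerivation ℂ L L, ∀ i : Fin N, D (Y i) = w (i + 1) • Y i := by
  let f : L →ₗ[ℂ] L := Y.constr ℂ fun i => w (i + 1) • Y i
  have hf : ∀ i, f (Y i) = w (i + 1) • Y i := fun i => Y.constr_basis ℂ _ i
  refine ⟨derivationOfBasis Y f fun i j hij => ?_, hf⟩
  rw [hf, hf, smul_lie, lie_smul, ← add_smul, hY i j hij, map_sum, Finset.smul_sum]
  refine Finset.sum_congr rfl fun l _ => ?_
  rw [map_smul, hf, smul_smul, smul_smul]
  by_cases hc : c (i + 1) (j + 1) (l + 1) = 0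
  · simp [hc]
  · rw [hw _ _ _ (by omega) (by simpa using hij) (by omega) (by omega) hc, mul_comm]

/-! ### Completeness from a diagonal derivation with distinct nonzero eigenvalues -/

section Complete

variable {ι L : Type*} [LieRing L] [LieAlgebra ℂ L]

/-- The derivations that are diagonal in a given basis. -/
def diagonalTorus (Y : Basis ι ℂ L) : LieSubalgebra ℂ (LieDerivation ℂ L L) where
  carrier := {D | ∀ i, ∃ c : ℂ, D (Y i) = c • Y i}
  add_mem' {D E} hD hE i := by
    obtain ⟨c, hc⟩ := hD i
    obtain ⟨d, hd⟩ := hE i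
    exact ⟨c + d, by simp [hc, hd, add_smul]⟩
  zero_mem' i := ⟨0, by simp⟩
  smul_mem' r D hD i := by
    obtain ⟨c, hc⟩ := hD i
    exact ⟨r * c, by simp [hc, mul_smul]⟩
  lie_mem' {D E} hD hE i := by
    obtain ⟨c, hc⟩ := hD i
    obtain ⟨d, hd⟩ := hE i
    exact ⟨0, by simp [hc, hd, smul_smul, mul_comm c d]⟩

theorem commute_of_mem_diagonalTorus {Y : Basis ι ℂ L} {D E : LieDerivation ℂ L L}
    (hD : D ∈ diagonalTorus Y) (hE : E ∈ diagonalTorus Y) : ⁅D, E⁆ = 0 := by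
  have : (⁅D, E⁆ : LieDerivation ℂ L L).toLinearMap = 0 := Y.ext fun i => by
    obtain ⟨c, hc⟩ := hD i
    obtain ⟨d, hd⟩ := hE i
    change ⁅D, E⁆ (Y i) = 0
    simp [hc, hd, smul_smul, mul_comm c d]
  ext x
  exact LinearMap.congr_fun this x

theorem repr_apply_of_diagonal (Y : Basis ι ℂ L) (f : L →ₗ[ℂ] L) (w : ι → ℂ)
    (hf : ∀ i, f (Y i) = w i • Y i) (x : L) (j : ι) :
    Y.repr (f x) j = w j * Y.repr x j := by
  have : (Y.coord j).comp f = w j • Y.coord j := Y.ext fun i => by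
    classical
    simp only [LinearMap.comp_apply, hf, map_smul, LinearMap.smul_apply,
      Basis.coord_apply, Basis.repr_self, smul_eq_mul, Finsupp.single_apply]
    split_ifs with h <;> simp [h]
  exact LinearMap.congr_fun this x

/-- The eigenspaces of `D` are lines, and `f` preserves each of them. -/
theorem mem_diagonalTorus_of_commute (Y : Basis ι ℂ L) (D : LieDerivation ℂ L L) (w : ι → ℂ)
    (hD : ∀ i, D (Y i) = w i • Y i) (hw : Function.Injective w) {f : LieDerivation ℂ L L}
    (hf : ∀ x, f (D x) = D (f x)) : f ∈ diagonalTorus Y := by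
  intro i
  refine ⟨Y.repr (f (Y i)) i, Y.ext_elem fun j => ?_⟩
  classical
  have h := repr_apply_of_diagonal Y (D : L →ₗ[ℂ] L) w hD (f (Y i)) j
  rw [LieDerivation.coeFn_coe, ← hf, hD, map_smul, map_smul, Finsupp.smul_apply, smul_eq_mul] at h
  rw [map_smul, Y.repr_self, Finsupp.smul_apply, smul_eq_mul, Finsupp.single_apply]
  split_ifs with hij
  · rw [hij, mul_one]
  · have : (w i - w j) * Y.repr (f (Y i)) j = 0 := by linear_combination h
    rcases mul_eq_zero.1 this with h0 | h0
    · exact absurd (hw (sub_eq_zero.1 h0)) hij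
    · simp [h0]

/-- A torus containing the diagonal one contains `D` and is abelian, so all its elements commute
with `D` and are diagonal. -/
theorem isMaximalTorus_diagonalTorus [Fintype ι] (Y : Basis ι ℂ L) (D : LieDerivation ℂ L L)
    (w : ι → ℂ) (hD : ∀ i, D (Y i) = w i • Y i) (hw : Function.Injective w) :
    IsMaximalTorus L (diagonalTorus Y) := by
  have hmem : D ∈ diagonalTorus Y := fun i => ⟨w i, hD i⟩
  refine ⟨⟨⟨fun a b => Subtype.ext (commute_of_mem_diagonalTorus a.2 b.2)⟩, fun E hE => ?_⟩,
    fun t ht hle E hE => ?_⟩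
  · choose c hc using hE
    exact isSemisimple_of_diagonal Y _ c hc
  · refine mem_diagonalTorus_of_commute Y D w hD hw fun x => ?_
    have := ht.1
    have h0 : (⁅(⟨E, hE⟩ : t), (⟨D, hle hmem⟩ : t)⁆ : t) = 0 := trivial_lie_zero _ _ _ _
    have h1 : ⁅E, D⁆ = 0 := congrArg Subtype.val h0
    have h2 := LieDerivation.congr_fun h1 x
    rw [LieDerivation.commutator_apply, LieDerivation.zero_apply] at h2
    exact sub_eq_zero.1 h2

/-- Since `D` is invertible on `L`, a derivation can be corrected by an inner one so that it sends
`D` into `t`. It then kills `t` and acts on `L` by a derivation commuting with `D`, that is, by an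
element of `t`. -/
theorem isCompleteLie_diagonalTorus [Fintype ι] (Y : Basis ι ℂ L) (D : LieDerivation ℂ L L)
    (w : ι → ℂ) (hD : ∀ i, D (Y i) = w i • Y i) (hw : Function.Injective w)
    (hw0 : ∀ i, w i ≠ 0) : IsCompleteLie (L ⋊⁅(diagonalTorus Y).incl⁆ diagonalTorus Y) := by
  have hmem : D ∈ diagonalTorus Y := fun i => ⟨w i, hD i⟩
  set T : diagonalTorus Y := ⟨D, hmem⟩
  have hinv : ∀ x, ∃ u, D u = x := fun x => by
    refine ⟨Y.constr ℂ (fun i => (w i)⁻¹ • Y i) x, ?_⟩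
    have : (D : L →ₗ[ℂ] L).comp (Y.constr ℂ fun i => (w i)⁻¹ • Y i) = LinearMap.id :=
      Y.ext fun i => by
        simp only [LinearMap.comp_apply, Y.constr_basis, map_smul, LieDerivation.coeFn_coe, hD,
          smul_smul, inv_mul_cancel₀ (hw0 i), one_smul, LinearMap.id_apply]
    exact LinearMap.congr_fun this x
  have hinj : ∀ x, D x = 0 → x = 0 := fun x hx => Y.ext_elem fun i => by
    have h := repr_apply_of_diagonal Y (D : L →ₗ[ℂ] L) w hD x i
    rw [LieDerivation.coeFn_coe, hx, map_zero, Finsupp.zero_apply] at h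
    simpa [hw0 i] using h.symm
  have hab : ∀ a b : diagonalTorus Y, ⁅a, b⁆ = 0 := fun a b =>
    Subtype.ext (commute_of_mem_diagonalTorus a.2 b.2)
  refine ⟨?_, ?_⟩
  · rw [LieSubmodule.eq_bot_iff]
    rintro ⟨x, s⟩ hz
    rw [LieModule.mem_maxTrivSubmodule] at hz
    have h1 := congrArg SemiDirectSum.left (hz ⟨0, T⟩)
    have hx : x = 0 := hinj x (by simpa [T] using h1)
    subst hx
    have hs : s = 0 := Subtype.ext <| LieDerivation.ext fun y => by
      have h2 := congrArg SemiDirectSum.left (hz ⟨y, 0⟩)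
      simpa using h2
    rw [hs]; rfl
  · have key : ∀ Δ : LieDerivation ℂ (L ⋊⁅(diagonalTorus Y).incl⁆ diagonalTorus Y)
        (L ⋊⁅(diagonalTorus Y).incl⁆ diagonalTorus Y), (Δ ⟨0, T⟩).left = 0 →
        ∃ x : L ⋊⁅(diagonalTorus Y).incl⁆ diagonalTorus Y, ∀ y, Δ y = ⁅x, y⁆ := by
      intro Δ hΔ
      -- Applying `Δ` to the vanishing bracket of `T` and `d` shows that `D` kills the `L`-component
      -- of `Δ d`.
      have h1 : ∀ d, (Δ ⟨0, d⟩).left = 0 := fun d => by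
        have h := Δ.apply_lie_eq_add ⟨0, T⟩ ⟨0, d⟩
        have h' := congrArg SemiDirectSum.left h
        have h0 : ⁅(⟨0, T⟩ : L ⋊⁅(diagonalTorus Y).incl⁆ diagonalTorus Y),
            (⟨0, d⟩ : L ⋊⁅(diagonalTorus Y).incl⁆ diagonalTorus Y)⁆ = 0 := by
          simp [hab]
        rw [h0, map_zero] at h'
        exact hinj _ (by simpa [T, hΔ] using h'.symm)
      have h2 : ∀ y, (Δ ⟨y, 0⟩).right = 0 := fun y => by
        obtain ⟨x, rfl⟩ := hinv y
        have h := congrArg SemiDirectSum.right (Δ.apply_lie_eq_add ⟨0, T⟩ ⟨x, 0⟩)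
        have h0 : ⁅(⟨0, T⟩ : L ⋊⁅(diagonalTorus Y).incl⁆ diagonalTorus Y),
            (⟨x, 0⟩ : L ⋊⁅(diagonalTorus Y).incl⁆ diagonalTorus Y)⁆
            = ⟨D x, 0⟩ := by simp [T]
        rw [h0] at h
        simpa [hab] using h
      let f : LieDerivation ℂ L L :=
        { toFun := fun y => (Δ ⟨y, 0⟩).left
          map_add' := fun a b => by
            have h := congrArg SemiDirectSum.left (map_add Δ ⟨a, 0⟩ ⟨b, 0⟩)
            simpa using h
          map_smul' := fun r a => by
            have h := congrArg SemiDirectSum.left (map_smul Δ r ⟨a, 0⟩)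
            simpa using h
          leibniz' := fun a b => by
            have h := congrArg SemiDirectSum.left (Δ.apply_lie_eq_sub ⟨a, 0⟩ ⟨b, 0⟩)
            simpa [h2] using h }
      have hfa : ∀ y, f y = (Δ ⟨y, 0⟩).left := fun y => rfl
      have h3 : ∀ (d : diagonalTorus Y) y,
          f ((d : LieDerivation ℂ L L) y) = (d : LieDerivation ℂ L L) (f y) +
            ((Δ ⟨0, d⟩).right : LieDerivation ℂ L L) y := fun d y => by
        have h := congrArg SemiDirectSum.left (Δ.apply_lie_eq_add ⟨0, d⟩ ⟨y, 0⟩)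
        have h0 : ⁅(⟨0, d⟩ : L ⋊⁅(diagonalTorus Y).incl⁆ diagonalTorus Y),
            (⟨y, 0⟩ : L ⋊⁅(diagonalTorus Y).incl⁆ diagonalTorus Y)⁆
            = ⟨(d : LieDerivation ℂ L L) y, 0⟩ := by simp
        rw [h0] at h
        simpa [h1, hfa] using h
      -- By `h3` this component is the commutator of `f` with a diagonal map, so its diagonal
      -- entries vanish; being diagonal itself, it is zero.
      have h4 : ∀ d, (Δ ⟨0, d⟩).right = 0 := fun d => by
        refine Subtype.ext <| LieDerivation.ext fun y => ?_
        suffices h : (((Δ ⟨0, d⟩).right : LieDerivation ℂ L L) : L →ₗ[ℂ] L) = 0 from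
          LinearMap.congr_fun h y
        refine Y.ext fun i => ?_
        obtain ⟨c, hc⟩ := (Δ ⟨0, d⟩).right.2 i
        choose e he using d.2
        have h := congrArg (fun z => Y.repr z i) (h3 d (Y i))
        have h' := repr_apply_of_diagonal Y ((d : LieDerivation ℂ L L) : L →ₗ[ℂ] L) e he
          (f (Y i)) i
        rw [LieDerivation.coeFn_coe] at h'
        simp only [he, hc, map_smul, map_add, Finsupp.add_apply, h', Finsupp.smul_apply,
          smul_eq_mul, Y.repr_self, Finsupp.single_eq_same] at h
        have hc0 : c = 0 := by linear_combination -h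
        rw [LieDerivation.coeFn_coe, hc, hc0]; simp
      have hf : f ∈ diagonalTorus Y := mem_diagonalTorus_of_commute Y D w hD hw fun x => by
        have := h3 T x
        rw [h4] at this
        simpa [T] using this
      refine ⟨⟨0, ⟨f, hf⟩⟩, fun z => ?_⟩
      obtain ⟨y, s⟩ := z
      have hz : (⟨y, s⟩ : L ⋊⁅(diagonalTorus Y).incl⁆ diagonalTorus Y) = ⟨y, 0⟩ + ⟨0, s⟩ := by
        simp
      rw [hz, map_add, ← hz]
      refine SemiDirectSum.ext ?_ ?_
      · simp [h1, hfa]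
      · simp [h2, h4, hab]
    intro Δ
    obtain ⟨u, hu⟩ := hinv (Δ ⟨0, T⟩).left
    -- The bracket of `u` with `T` is `-D u`, which cancels the `L`-component of `Δ T`.
    obtain ⟨x, hx⟩ := key (Δ + LieDerivation.ad ℂ _ ⟨u, 0⟩) (by simp [T, hu])
    refine ⟨x - ⟨u, 0⟩, fun y => ?_⟩
    have h := hx y
    rw [LieDerivation.add_apply, LieDerivation.ad_apply_apply] at h
    rw [sub_lie, ← h, add_sub_cancel_right]

theorem isCompletable_of_diagonal [Fintype ι] (Y : Basis ι ℂ L) (D : LieDerivation ℂ L L)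
    (w : ι → ℂ) (hD : ∀ i, D (Y i) = w i • Y i) (hw : Function.Injective w)
    (hw0 : ∀ i, w i ≠ 0) : IsCompletable L :=
  ⟨_, isMaximalTorus_diagonalTorus Y D w hD hw, isCompleteLie_diagonalTorus Y D w hD hw hw0⟩

end Complete

/-! ### The four families are completable -/

section Tables

variable {L : Type*} [LieRing L] [LieAlgebra ℂ L]

theorem coefGap_zero (d i : ℕ) : coefGap (fun _ => 0) d i = 0 := by
  induction d using Nat.strong_induction_on generalizing i with
  | _ d ih =>
    match d with
    | 0 => rfl
    | 1 => rfl
    | d + 2 => simp [coefGap, ih (d + 1) (by omega), ih d (by omega)]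

theorem coef_zero (i j : ℕ) : coef (fun _ => 0) i j = 0 := coefGap_zero _ _

theorem isCompletable_of_weights {N : ℕ} {c : ℕ → ℕ → ℕ → ℂ} (h : HasTable L N c) (w : ℕ → ℕ)
    (hw : ∀ i j l : ℕ, 1 ≤ i → i < j → 1 ≤ l → l ≤ N → c i j l ≠ 0 → w l = w i + w j)
    (hpos : ∀ i, 1 ≤ i → i ≤ N → w i ≠ 0)
    (hinj : ∀ i j, 1 ≤ i → i < j → j ≤ N → w i ≠ w j) : IsCompletable L := by
  obtain ⟨Y, hY⟩ := h
  obtain ⟨D, hD⟩ := exists_diagonal_derivation Y hY (fun i => (w i : ℂ))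
    (fun i j l h1 h2 h3 h4 h5 => by rw [hw i j l h1 h2 h3 h4 h5]; push_cast; rfl)
  refine isCompletable_of_diagonal Y D (fun i => (w (i + 1) : ℂ)) hD (fun i j hij => ?_)
    (fun i => Nat.cast_ne_zero.2 (hpos _ (by omega) (by omega)))
  have hij : w (i + 1) = w (j + 1) := Nat.cast_injective hij
  rcases lt_trichotomy i j with h | h | h
  · exact absurd hij (hinj _ _ (by omega) (by simpa using h) (by omega))
  · exact h
  · exact absurd hij.symm (hinj _ _ (by omega) (by simpa using h) (by omega))

theorem isCompletable_of_tableA {N k : ℕ} {lam : ℕ → ℂ} (hk : 2 ≤ k)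
    (h : HasTable L N (tableA k lam)) : IsCompletable L := by
  -- `Y₁` has weight `1` and `Y₂` weight `k`; `k ≥ 2` keeps them apart.
  refine isCompletable_of_weights h (fun j => if j = 1 then 1 else j + k - 2) ?_ ?_ ?_
  · intro i j l hi hij hl hlN hc
    unfold tableA at hc
    split_ifs at hc <;> grind
  · grind
  · grind

theorem isCompletable_of_tableB {N k : ℕ} {lam : ℕ → ℂ} (hk : 2 ≤ k)
    (h : HasTable L N (tableB N k lam)) : IsCompletable L := by
  -- The weight of `Y_N` is the sum `(i + k - 2) + (N + 1 - i + k - 2)` imposed by the brackets with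
  -- value `± Y_N`.
  refine isCompletable_of_weights h
    (fun j => if j = 1 then 1 else if j = N then N + 2 * k - 3 else j + k - 2) ?_ ?_ ?_
  · intro i j l hi hij hl hlN hc
    unfold tableB at hc
    split_ifs at hc <;> grind
  · grind
  · grind

theorem tableL_eq_tableA : tableL = tableA 2 fun _ => 0 := by
  funext i j l
  unfold tableL tableA
  rw [coef_zero]
  split_ifs <;> grind

theorem exists_basis_add {N : ℕ} (Y : Basis (Fin N) ℂ L) (a : Fin N) (v : L)
    (hv : Y.repr v a = 0) :
    ∃ X : Basis (Fin N) ℂ L, X a = Y a + v ∧ ∀ i, i ≠ a → X i = Y i := by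
  have h : Y.coord a v = 0 := hv
  refine ⟨Y.map (LinearEquiv.transvection h), ?_, fun i hi => ?_⟩
  · simp [LinearMap.transvection.apply]
  · simp [LinearMap.transvection.apply, Finsupp.single_eq_of_ne hi.symm]

theorem hasTable_iff {N : ℕ} {c : ℕ → ℕ → ℕ → ℂ} : HasTable L N c ↔
    ∃ Y : Basis (Fin N) ℂ L, ∀ i j : Fin N, i < j → ∀ l : Fin N,
      Y.repr ⁅Y i, Y j⁆ l = c (i + 1) (j + 1) (l + 1) := by
  refine exists_congr fun Y => forall₃_congr fun i j _ => ?_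
  rw [← Y.repr.injective.eq_iff, Finsupp.ext_iff]
  refine forall_congr' fun l => ?_
  rw [Y.repr_sum_self]

/-- Replacing `Y₁` by `Y₁ + s Y₂` in a multiplication table. -/
theorem HasTable.change {N : ℕ} {c c' : ℕ → ℕ → ℕ → ℂ} (hN : 2 ≤ N) (h : HasTable L N c) (s : ℂ)
    (h0 : ∀ i j, 1 ≤ i → i < j → j ≤ N → c i j 1 = 0 ∧ c' i j 1 = 0)
    (h1 : ∀ l, 2 ≤ l → l ≤ N → c' 1 2 l = c 1 2 l)
    (h2 : ∀ j l, 3 ≤ j → j ≤ N → 2 ≤ l → l ≤ N → c' 1 j l = c 1 j l + s * c 2 j l)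
    (h3 : ∀ i j l, 2 ≤ i → i < j → j ≤ N → 2 ≤ l → l ≤ N → c' i j l = c i j l) :
    HasTable L N c' := by
  obtain ⟨Y, hY⟩ := h
  obtain ⟨p, hp⟩ : ∃ p : Fin N, (p : ℕ) = 0 := ⟨⟨0, by omega⟩, rfl⟩
  obtain ⟨q, hq⟩ : ∃ q : Fin N, (q : ℕ) = 1 := ⟨⟨1, by omega⟩, rfl⟩
  have hpq : q ≠ p := fun h => by rw [h] at hq; omega
  obtain ⟨X, hX0, hX⟩ := exists_basis_add Y p (s • Y q) (by simp [Finsupp.single_eq_of_ne hpq.symm])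
  refine ⟨X, fun i j hij' => ?_⟩
  have hij : (i : ℕ) < j := hij'
  have hj : j ≠ p := fun h => by rw [h] at hij; omega
  have hsum : ∀ l : Fin N, c' (i + 1) (j + 1) (l + 1) • X l = c' (i + 1) (j + 1) (l + 1) • Y l := by
    intro l
    by_cases hl : l = p
    · rw [hl, hp, zero_add, (h0 _ _ (by omega) (by omega) (by omega)).2, zero_smul, zero_smul]
    · rw [hX l hl]
  rw [Finset.sum_congr rfl fun l _ => hsum l, hX j hj]
  have z : ∀ l : Fin N, (l : ℕ) + 1 = 1 ∨ 2 ≤ (l : ℕ) + 1 := fun l => by omega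
  by_cases hi : i = p
  · rw [hi, hX0, add_lie, smul_lie, hY p j (hi ▸ hij'), hp]
    by_cases hj1 : j = q
    · rw [hj1, lie_self, smul_zero, add_zero, hq]
      refine Finset.sum_congr rfl fun l _ => ?_
      rcases z l with hl | hl
      · rw [hl, (h0 _ _ (by omega) (by omega) (by omega)).2,
          (h0 _ _ (by omega) (by omega) (by omega)).1]
      · simp only [zero_add, Nat.reduceAdd]
        rw [h1 _ hl (by omega)]
    · have hj2 : (1 : ℕ) < j := by
        have := fun h => hj1 (Fin.ext h)
        omega
      rw [hY q j (by rw [Fin.lt_def]; omega), Finset.smul_sum, ← Finset.sum_add_distrib, hq]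
      refine Finset.sum_congr rfl fun l _ => ?_
      rw [smul_smul, ← add_smul]
      congr 1
      simp only [zero_add, Nat.reduceAdd]
      rcases z l with hl | hl
      · rw [hl, (h0 1 _ (by omega) (by omega) (by omega)).2,
          (h0 1 _ (by omega) (by omega) (by omega)).1,
          (h0 2 _ (by omega) (by omega) (by omega)).1, mul_zero, add_zero]
      · rw [h2 _ _ (by omega) (by omega) hl (by omega)]
  · have hi1 : 1 ≤ (i : ℕ) := by
      have := fun h => hi (Fin.ext h)
      omega
    rw [hX i hi, hY i j hij']
    refine Finset.sum_congr rfl fun l _ => ?_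
    rcases z l with hl | hl
    · rw [hl, (h0 _ _ (by omega) (by omega) (by omega)).2,
        (h0 _ _ (by omega) (by omega) (by omega)).1]
    · rw [h3 _ _ _ (by omega) (by omega) (by omega) hl (by omega)]

/-- In `Q_N` the brackets of `Y₁` and of `Y₂` with `Y_{N-1}` are `Y_N` and `-Y_N`, so `Y₁ + Y₂`
kills `Y_{N-1}`, as the first vector of `B` must. -/
theorem tableB_zero_of_tableQ {N : ℕ} (hN : Even N) (hN2 : 2 ≤ N) (h : HasTable L N (tableQ N)) :
    HasTable L N (tableB N 2 fun _ => 0) := by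
  -- For `N = 3` the vector `Y_{N-1}` would be `Y₂` itself and nothing would cancel.
  have hN3 : N ≠ 3 := by rintro rfl; exact absurd hN (by decide)
  refine h.change hN2 1 ?_ ?_ ?_ ?_ <;> intros <;> unfold tableQ tableB <;> simp only [coef_zero] <;>
    split_ifs <;> grind

theorem tableQ_of_tableB_zero {N k : ℕ} (hN : Even N) (hN2 : 2 ≤ N)
    (h : HasTable L N (tableB N k fun _ => 0)) : HasTable L N (tableQ N) := by
  have hN3 : N ≠ 3 := by rintro rfl; exact absurd hN (by decide)
  refine h.change hN2 (-1) ?_ ?_ ?_ ?_ <;> intros <;> unfold tableQ tableB <;>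
    simp only [coef_zero] <;> split_ifs <;> grind

theorem isCompletable_of_families
    (h : (∃ N : ℕ, IsoL L N) ∨ (∃ N : ℕ, IsoQ L N) ∨
      (∃ (N k : ℕ) (lam : ℕ → ℂ), IsoA L N k lam) ∨
      (∃ (N k : ℕ) (lam : ℕ → ℂ), IsoB L N k lam)) : IsCompletable L := by
  rcases h with ⟨N, h⟩ | ⟨N, hN, h⟩ | ⟨N, k, lam, hk, -, -, h⟩ | ⟨N, k, lam, -, hk, -, -, h⟩
  · unfold IsoL at h
    rw [tableL_eq_tableA] at h
    exact isCompletable_of_tableA le_rfl h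
  · rcases Nat.eq_zero_or_pos N with rfl | hpos
    · obtain ⟨Y, -⟩ := h
      exact isCompletable_of_tableA (lam := fun _ => 0) le_rfl ⟨Y, fun i => i.elim0⟩
    · have hN2 : 2 ≤ N := by obtain ⟨r, rfl⟩ := hN; omega
      exact isCompletable_of_tableB le_rfl (tableB_zero_of_tableQ hN hN2 h)
  · exact isCompletable_of_tableA hk h
  · exact isCompletable_of_tableB hk h

end Tables

/-! ### Bases adapted to a flag -/

section Flags

/-- `y 1, …, y N` is a basis adapted to the flag `F 1 ⊇ ⋯ ⊇ F (N + 1) = 0`. -/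
structure IsFlagBasis {V : Type*} [AddCommGroup V] [Module ℂ V] (N : ℕ)
    (F : ℕ → Submodule ℂ V) (y : ℕ → V) : Prop where
  top : F 1 = ⊤
  bot : ∀ i, N < i → F i = ⊥
  zero : ∀ i, N < i → y i = 0
  step : ∀ i, 1 ≤ i → i ≤ N → F i = Submodule.span ℂ {y i} ⊔ F (i + 1)
  notMem : ∀ i, 1 ≤ i → i ≤ N → y i ∉ F (i + 1)

namespace IsFlagBasis

variable {V : Type*} [AddCommGroup V] [Module ℂ V] {N : ℕ} {F : ℕ → Submodule ℂ V} {y : ℕ → V}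

theorem succ_le (h : IsFlagBasis N F y) {i : ℕ} (hi : 1 ≤ i) : F (i + 1) ≤ F i := by
  rcases Nat.lt_or_ge N i with hN | hN
  · rw [h.bot _ (by omega)]; exact bot_le
  · rw [h.step i hi hN]; exact le_sup_right

theorem antitone (h : IsFlagBasis N F y) {i j : ℕ} (hi : 1 ≤ i) (hij : i ≤ j) : F j ≤ F i := by
  induction j, hij using Nat.le_induction with
  | base => exact le_rfl
  | succ j hj ih => exact (h.succ_le (hi.trans hj)).trans ih

theorem mem (h : IsFlagBasis N F y) {i : ℕ} (hi : 1 ≤ i) : y i ∈ F i := by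
  rcases Nat.lt_or_ge N i with hN | hN
  · rw [h.zero _ hN]; exact zero_mem _
  · rw [h.step i hi hN]
    exact Submodule.mem_sup_left (Submodule.mem_span_singleton_self _)

theorem mem_of_le (h : IsFlagBasis N F y) {i j : ℕ} (hi : 1 ≤ i) (hij : i ≤ j) : y j ∈ F i :=
  h.antitone hi hij (h.mem (hi.trans hij))

theorem exists_sub_mem (h : IsFlagBasis N F y) {i : ℕ} (hi : 1 ≤ i) {x : V} (hx : x ∈ F i) :
    ∃ a : ℂ, x - a • y i ∈ F (i + 1) := by
  rcases Nat.lt_or_ge N i with hN | hN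
  · rw [h.bot _ hN, Submodule.mem_bot] at hx
    exact ⟨0, by simp [hx]⟩
  · rw [h.step i hi hN, Submodule.mem_sup] at hx
    obtain ⟨u, hu, v, hv, rfl⟩ := hx
    obtain ⟨a, rfl⟩ := Submodule.mem_span_singleton.1 hu
    exact ⟨a, by simpa using hv⟩

theorem eq_zero (h : IsFlagBasis N F y) {i : ℕ} (hi : 1 ≤ i) (hN : i ≤ N) {a : ℂ}
    (ha : a • y i ∈ F (i + 1)) : a = 0 := by
  by_contra h0
  exact h.notMem i hi hN ((Submodule.smul_mem_iff _ h0).1 ha)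

theorem ne_zero (h : IsFlagBasis N F y) {i : ℕ} (hi : 1 ≤ i) (hN : i ≤ N) : y i ≠ 0 :=
  fun h0 => h.notMem i hi hN (h0 ▸ zero_mem _)

/-- A submodule containing `y j` for all `j ≥ i` contains `F i`. -/
theorem le_of_forall_mem (h : IsFlagBasis N F y) (P : Submodule ℂ V) {i : ℕ} (hi : 1 ≤ i)
    (hP : ∀ j, i ≤ j → j ≤ N → y j ∈ P) : F i ≤ P := by
  rcases Nat.lt_or_ge N i with hN | hN
  · rw [h.bot _ hN]; exact bot_le
  · refine Nat.decreasingInduction' (P := fun k => F k ≤ P) (m := i) (n := N + 1) ?_ (by omega) ?_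
    · intro k hk hik ih
      rw [h.step k (by omega) (by omega)]
      exact sup_le ((Submodule.span_singleton_le_iff_mem _ _).2 (hP k hik (by omega))) ih
    · rw [h.bot _ (by omega)]; exact bot_le

theorem exists_basis (h : IsFlagBasis N F y) (hN : finrank ℂ V = N) :
    ∃ b : Basis (Fin N) ℂ V, ∀ i : Fin N, b i = y (i + 1) := by
  have hs : ⊤ ≤ Submodule.span ℂ (Set.range fun i : Fin N => y (i + 1)) := by
    rw [← h.top]
    refine h.le_of_forall_mem _ le_rfl fun j h1 h2 => Submodule.subset_span ⟨⟨j - 1, by omega⟩, ?_⟩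
    simp only
    rw [Nat.sub_add_cancel h1]
  exact ⟨basisOfTopLeSpanOfCardEqFinrank _ hs (by simp [hN]), fun i => by simp⟩

theorem repr_eq_zero (h : IsFlagBasis N F y) (b : Basis (Fin N) ℂ V)
    (hb : ∀ i : Fin N, b i = y (i + 1)) {x : V} {i : ℕ} (hi : 1 ≤ i) (hx : x ∈ F i) (l : Fin N)
    (hl : (l : ℕ) + 1 < i) : b.repr x l = 0 := by
  have : F i ≤ LinearMap.ker (b.coord l) := h.le_of_forall_mem _ hi fun j h1 h2 => by
    have e : y j = b ⟨j - 1, by omega⟩ := by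
      rw [hb]; simp only; rw [Nat.sub_add_cancel (by omega)]
    rw [LinearMap.mem_ker, e, Basis.coord_apply, Basis.repr_self]
    exact Finsupp.single_eq_of_ne fun h => by rw [h] at hl; simp only at hl; omega
  exact this hx

/-- This is a triangular change of basis: each new vector has a nonzero leading coefficient and
leaves the flag unchanged. -/
theorem of_mem (h : IsFlagBasis N F y) {X : ℕ → V} (hX : ∀ i, 1 ≤ i → i ≤ N → X i ∈ F i)
    (hX' : ∀ i, 1 ≤ i → i ≤ N → X i ∉ F (i + 1)) (hz : ∀ i, N < i → X i = 0) :
    IsFlagBasis N F X := by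
  refine ⟨h.top, h.bot, hz, fun i hi hN => le_antisymm ?_ ?_, hX'⟩
  · rw [h.step i hi hN]
    refine sup_le ((Submodule.span_singleton_le_iff_mem _ _).2 ?_) le_sup_right
    obtain ⟨a, ha⟩ := h.exists_sub_mem hi (hX i hi hN)
    have ha0 : a ≠ 0 := by
      rintro rfl
      exact hX' i hi hN (by simpa using ha)
    rw [← Submodule.smul_mem_iff _ ha0]
    have : a • y i = X i - (X i - a • y i) := by abel
    rw [this]
    exact sub_mem (Submodule.mem_sup_left (Submodule.mem_span_singleton_self _))
      (Submodule.mem_sup_right ha)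
  · exact sup_le ((Submodule.span_singleton_le_iff_mem _ _).2 (hX i hi hN)) (h.succ_le hi)

end IsFlagBasis

end Flags

/-! ### The flag and the lower central series -/

section Nilpotent

open LieModule

variable {L : Type*} [LieRing L] [LieAlgebra ℂ L]

theorem lowerCentralSeries_eq_bot_of_succ (hnil : LieRing.IsNilpotent L) {k : ℕ}
    (h : lowerCentralSeries ℂ L L (k + 1) = lowerCentralSeries ℂ L L k) :
    lowerCentralSeries ℂ L L k = ⊥ := by
  obtain ⟨r, hr⟩ := (LieModule.isNilpotent_iff ℂ L L).1 hnil
  have : ∀ s, lowerCentralSeries ℂ L L (k + s) = lowerCentralSeries ℂ L L k := by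
    intro s
    induction s with
    | zero => rfl
    | succ s ih => rw [← add_assoc, lowerCentralSeries_succ, ih, ← lowerCentralSeries_succ, h]
  rw [← this r, eq_bot_iff, ← hr]
  exact antitone_lowerCentralSeries ℂ L L (by omega)

theorem lie_mem_lowerCentralSeries_succ (x : L) {z : L} {k : ℕ}
    (hz : z ∈ lowerCentralSeries ℂ L L k) : ⁅x, z⁆ ∈ lowerCentralSeries ℂ L L (k + 1) := by
  rw [lowerCentralSeries_succ]
  exact LieSubmodule.lie_mem_lie (LieSubmodule.mem_top x) hz

/-- In a nilpotent Lie algebra with a basis `y` such that `[y₁, yⱼ] = yⱼ₊₁` for `j ≥ 2` and `y₁` is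
not in the derived algebra, the flag is the lower central series. -/
theorem IsFlagBasis.lowerCentralSeries_eq {N : ℕ} {F : ℕ → Submodule ℂ L} {y : ℕ → L}
    (h : IsFlagBasis N F y) (hN : 3 ≤ N) (hnil : LieRing.IsNilpotent L)
    (h1 : y 1 ∉ lowerCentralSeries ℂ L L 1) (hy : ∀ j, 2 ≤ j → ⁅y 1, y j⁆ = y (j + 1)) (k : ℕ) :
    (lowerCentralSeries ℂ L L (k + 1)).toSubmodule = F (k + 3) := by
  have hmem : ∀ k j, k + 2 ≤ j → y j ∈ lowerCentralSeries ℂ L L k := by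
    intro k
    induction k with
    | zero => intro j _; simp
    | succ k ih =>
      intro j hj
      obtain ⟨j, rfl⟩ : ∃ i, j = i + 1 := ⟨j - 1, by omega⟩
      rw [← hy j (by omega)]
      exact lie_mem_lowerCentralSeries_succ _ (ih j (by omega))
  have hle : ∀ k, F (k + 2) ≤ (lowerCentralSeries ℂ L L k).toSubmodule := fun k =>
    h.le_of_forall_mem _ (by omega) fun j hj _ => hmem k j hj
  refine le_antisymm ?_ (hle (k + 1))
  induction k with
  | zero =>
    intro x hx
    by_contra hx3
    obtain ⟨a, ha⟩ := h.exists_sub_mem le_rfl (show x ∈ F 1 by rw [h.top]; trivial)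
    obtain ⟨b, hb⟩ := h.exists_sub_mem (by omega) ha
    have hab : a • y 1 + b • y 2 ∈ lowerCentralSeries ℂ L L 1 := by
      have : a • y 1 + b • y 2 = x - (x - a • y 1 - b • y 2) := by abel
      rw [this]
      exact sub_mem hx (hle 1 hb)
    have hb0 : b ≠ 0 := by
      rintro rfl
      rw [zero_smul, add_zero] at hab
      have ha0 : a = 0 := by
        by_contra ha0
        exact h1 (((lowerCentralSeries ℂ L L 1).toSubmodule.smul_mem_iff ha0).1 hab)
      subst ha0
      simp only [zero_smul, sub_zero] at hb
      exact hx3 hb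
    -- If the derived algebra contained a vector with `y 2`-coefficient `b ≠ 0` modulo `F 3`, then
    -- `y 1` alone would span `L` modulo the derived algebra. A nilpotent algebra generated by one
    -- element is abelian, but `y 3 ≠ 0`.
    have hdec : ∀ z : L, ∃ (α : ℂ) (p : L), p ∈ lowerCentralSeries ℂ L L 1 ∧ z = α • y 1 + p := by
      intro z
      obtain ⟨a', ha'⟩ := h.exists_sub_mem le_rfl (show z ∈ F 1 by rw [h.top]; trivial)
      obtain ⟨b', hb'⟩ := h.exists_sub_mem (by omega) ha'
      refine ⟨a' - b' / b * a, (b' / b) • (a • y 1 + b • y 2) + (z - a' • y 1 - b' • y 2),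
        add_mem (Submodule.smul_mem _ _ hab) (hle 1 hb'), ?_⟩
      rw [smul_add, smul_smul, smul_smul, div_mul_cancel₀ _ hb0, sub_smul]
      abel
    have hst : lowerCentralSeries ℂ L L (1 + 1) = lowerCentralSeries ℂ L L 1 := by
      refine le_antisymm (antitone_lowerCentralSeries ℂ L L (by omega)) ?_
      rw [lowerCentralSeries_succ ℂ L L 0, LieSubmodule.lie_le_iff]
      intro z _ w _
      obtain ⟨α, p, hp, rfl⟩ := hdec z
      obtain ⟨β, q, hq, rfl⟩ := hdec w
      have e : ⁅α • y 1 + p, β • y 1 + q⁆ = ⁅α • y 1 + p, q⁆ - ⁅β • y 1, p⁆ := by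
        rw [lie_add, add_lie, ← lie_skew (β • y 1) p, smul_lie, lie_smul, lie_self]
        simp only [smul_zero, zero_add]
        abel
      rw [e]
      exact sub_mem (lie_mem_lowerCentralSeries_succ _ hq) (lie_mem_lowerCentralSeries_succ _ hp)
    have h3 := hmem 1 3 le_rfl
    rw [lowerCentralSeries_eq_bot_of_succ hnil hst, LieSubmodule.mem_bot] at h3
    exact h.ne_zero (by omega) hN h3
  | succ k ih =>
    intro x hx
    by_contra hx3
    have hxk : x ∈ F (k + 3) := ih (antitone_lowerCentralSeries ℂ L L (by omega) hx)
    rcases Nat.lt_or_ge N (k + 3) with hk | hk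
    · rw [h.bot _ hk, Submodule.mem_bot] at hxk
      exact hx3 (hxk ▸ zero_mem _)
    obtain ⟨a, ha⟩ := h.exists_sub_mem (by omega) hxk
    have ha0 : a ≠ 0 := by
      rintro rfl
      exact hx3 (by simpa using ha)
    have hyk : y (k + 3) ∈ lowerCentralSeries ℂ L L (k + 1 + 1) := by
      rw [← LieSubmodule.mem_toSubmodule, ← Submodule.smul_mem_iff _ ha0]
      have : a • y (k + 3) = x - (x - a • y (k + 3)) := by abel
      rw [this]
      exact sub_mem hx (hle (k + 2) ha)
    -- A term that is too large by one step would coincide with its predecessor, so the series would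
    -- stop at a nonzero term.
    have hst : lowerCentralSeries ℂ L L (k + 1 + 1) = lowerCentralSeries ℂ L L (k + 1) := by
      refine le_antisymm (antitone_lowerCentralSeries ℂ L L (by omega)) fun z hz => ?_
      refine h.le_of_forall_mem (lowerCentralSeries ℂ L L (k + 1 + 1)).toSubmodule
        (i := k + 3) (by omega) (fun j hj hjN => ?_) (ih hz)
      rcases hj.eq_or_lt with rfl | hj
      · exact hyk
      · exact hmem _ _ hj
    have h3 := hmem (k + 1) (k + 3) le_rfl
    rw [lowerCentralSeries_eq_bot_of_succ hnil hst, LieSubmodule.mem_bot] at h3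
    exact h.ne_zero (by omega) hk h3

end Nilpotent

/-! ### Brackets of an adapted basis -/

section Adapted

variable {L : Type*} [LieRing L] [LieAlgebra ℂ L]

/-- An adapted basis of a filiform Lie algebra, with the corresponding flag. -/
structure IsAdapted (N : ℕ) (F : ℕ → Submodule ℂ L) (y : ℕ → L) : Prop
    extends IsFlagBasis N F y where
  lie_mem : ∀ (x : L) {i : ℕ} {z : L}, 2 ≤ i → z ∈ F i → ⁅x, z⁆ ∈ F (i + 1)
  lie_one : ∀ j, 2 ≤ j → ⁅y 1, y j⁆ = y (j + 1)
  lie_two_three : ⁅y 2, y 3⁆ ∈ F 5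

namespace IsAdapted

variable {N : ℕ} {F : ℕ → Submodule ℂ L} {y : ℕ → L}

theorem lie_mem_of_basis (h : IsAdapted N F y) {i j : ℕ} (hi : 1 ≤ i) (hj : 1 ≤ j)
    (P : Submodule ℂ L) (hP : ∀ i' j', i ≤ i' → j ≤ j' → ⁅y i', y j'⁆ ∈ P) {x z : L}
    (hx : x ∈ F i) (hz : z ∈ F j) : ⁅x, z⁆ ∈ P := by
  have h1 : ∀ i', i ≤ i' → ⁅y i', z⁆ ∈ P := fun i' hi' =>
    h.le_of_forall_mem (P.comap (ad ℂ L (y i') : L →ₗ[ℂ] L)) hj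
      (fun j' hj' _ => by simpa using hP i' j' hi' hj') hz
  have h2 := h.le_of_forall_mem (P.comap (ad ℂ L z : L →ₗ[ℂ] L)) hi
    (fun i' hi' _ => by
      rw [Submodule.mem_comap, ad_apply, ← lie_skew]
      exact neg_mem (h1 i' hi')) hx
  rw [Submodule.mem_comap, ad_apply] at h2
  rw [← lie_skew]
  exact neg_mem h2

/-- This is one step short of the expected filtration; the missing step is gained in
`lie_mem_of_add_le`. The second index is lowered by the Leibniz rule for `y 1`. -/
theorem lie_basis_mem (h : IsAdapted N F y) {i j : ℕ} (hi : 2 ≤ i) (hj : 2 ≤ j) :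
    ⁅y i, y j⁆ ∈ F (i + j - 1) := by
  induction j, hj using Nat.le_induction generalizing i with
  | base =>
    rw [← lie_skew]
    exact neg_mem (h.lie_mem _ hi (h.mem (by omega)))
  | succ j hj ih =>
    have e : ⁅y i, y (j + 1)⁆ = ⁅y 1, ⁅y i, y j⁆⁆ - ⁅y (i + 1), y j⁆ := by
      rw [leibniz_lie (y 1), h.lie_one i hi, h.lie_one j hj]; abel
    rw [e]
    refine sub_mem ?_ ?_
    · have := h.lie_mem (y 1) (by omega) (ih hi)
      rwa [show i + j - 1 + 1 = i + (j + 1) - 1 by omega] at this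
    · have := ih (i := i + 1) (by omega)
      rwa [show i + 1 + j - 1 = i + (j + 1) - 1 by omega] at this

theorem lie_mem_add (h : IsAdapted N F y) {i j m : ℕ} (hi : 2 ≤ i) (hj : 2 ≤ j)
    (hm : m + 1 ≤ i + j) (hm1 : 1 ≤ m) {x z : L} (hx : x ∈ F i) (hz : z ∈ F j) : ⁅x, z⁆ ∈ F m :=
  h.lie_mem_of_basis (by omega) (by omega) _ (fun i' j' hi' hj' =>
    h.antitone hm1 (by omega) (h.lie_basis_mem (hi.trans hi') (hj.trans hj'))) hx hz

theorem lie_succ_eq (h : IsAdapted N F y) {i j : ℕ} (hi : 2 ≤ i) (hj : 2 ≤ j) :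
    ⁅y (i + 1), y j⁆ = ⁅y 1, ⁅y i, y j⁆⁆ - ⁅y i, y (j + 1)⁆ := by
  rw [leibniz_lie (y 1), h.lie_one i hi, h.lie_one j hj]; abel

/-- The shape of the brackets in the first graded degree that is not known to vanish. -/
theorem exists_lie_sub_mem (h : IsAdapted N F y) {m : ℕ} (hm : 3 ≤ m) (hmN : m ≤ N)
    (H : ∀ i j, 2 ≤ i → 2 ≤ j → i + j ≤ m → ⁅y i, y j⁆ ∈ F (i + j)) :
    ∃ c : ℂ, (∀ i j, 2 ≤ i → 2 ≤ j → i + j = m + 1 →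
      ⁅y i, y j⁆ - ((-1) ^ i * c) • y m ∈ F (m + 1)) ∧ (Odd m → c = 0) := by
  obtain ⟨c, hc⟩ := h.exists_sub_mem (i := m) (by omega)
    (h.lie_mem_add (i := 2) (j := m - 1) (by omega) (by omega) (by omega) (by omega)
      (h.mem (by omega)) (h.mem (by omega)))
  have key : ∀ i, 2 ≤ i → ∀ j, 2 ≤ j → i + j = m + 1 →
      ⁅y i, y j⁆ - ((-1) ^ i * c) • y m ∈ F (m + 1) := by
    intro i hi
    induction i, hi using Nat.le_induction with
    | base =>
      intro j hj hij
      obtain rfl : j = m - 1 := by omega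
      simpa using hc
    | succ i hi ih =>
      intro j hj hij
      -- By `H` the bracket one degree lower contributes nothing modulo `F (m + 1)`, so moving one
      -- unit between the indices only changes the sign.
      have h1 := h.lie_mem (y 1) (by omega) (H i j hi hj (by omega))
      rw [show i + j + 1 = m + 1 by omega] at h1
      have h2 := ih (j + 1) (by omega) (by omega)
      rw [h.lie_succ_eq hi hj]
      have e : ⁅y 1, ⁅y i, y j⁆⁆ - ⁅y i, y (j + 1)⁆ - ((-1) ^ (i + 1) * c) • y m =
          ⁅y 1, ⁅y i, y j⁆⁆ - (⁅y i, y (j + 1)⁆ - ((-1) ^ i * c) • y m) := by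
        rw [pow_succ]; module
      rw [e]
      exact sub_mem h1 h2
  refine ⟨c, fun i j hi hj hij => key i hi j hj hij, fun hodd => ?_⟩
  obtain ⟨p, rfl⟩ := hodd
  -- For odd `m` the middle bracket is that of a vector with itself.
  have hp := key (p + 1) (by omega) (p + 1) (by omega) (by omega)
  rw [lie_self, zero_sub, ← neg_smul] at hp
  have := h.eq_zero (by omega) hmN hp
  simpa using this

/-- The coefficient of the previous lemma vanishes below the top degree. -/
theorem lie_coeff_eq_zero (h : IsAdapted N F y) {m : ℕ} (hm : 3 ≤ m) (hmN : m < N)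
    (H : ∀ i j, 2 ≤ i → 2 ≤ j → i + j ≤ m → ⁅y i, y j⁆ ∈ F (i + j)) {c : ℂ}
    (hc : ∀ i j, 2 ≤ i → 2 ≤ j → i + j = m + 1 →
      ⁅y i, y j⁆ - ((-1) ^ i * c) • y m ∈ F (m + 1)) (hodd : Odd m → c = 0) : c = 0 := by
  rcases Nat.even_or_odd m with ⟨p, hp⟩ | ho
  swap
  · exact hodd ho
  have hm4 : 4 ≤ m := by omega
  rcases hm4.eq_or_lt with rfl | hm6
  -- In degree `4` the coefficient vanishes by the normalization of `y 2`.
  · have h1 := hc 2 3 le_rfl (by omega) rfl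
    have h2 := sub_mem h.lie_two_three h1
    rw [sub_sub_cancel] at h2
    simpa using h.eq_zero (by omega) hmN.le h2
  · have hm6 : 6 ≤ m := by omega
    obtain ⟨g, hg⟩ := h.exists_sub_mem (i := m + 1) (by omega)
      (h.lie_mem_add (i := 2) (j := m) le_rfl (by omega) (by omega) (by omega)
        (h.mem (by omega)) (h.mem (by omega)))
    -- One degree higher, `c` enters as an inhomogeneous term of the recursion. With `m = 2p`, the
    -- vanishing middle bracket will give `g = (p - 1) c`.
    have key : ∀ i, 2 ≤ i → ∀ j, 2 ≤ j → i + j = m + 2 →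
        ⁅y i, y j⁆ - ((-1) ^ i * (g - (i - 2) * c)) • y (m + 1) ∈ F (m + 2) := by
      intro i hi
      induction i, hi using Nat.le_induction with
      | base =>
        intro j hj hij
        obtain rfl : j = m := by omega
        simpa using hg
      | succ i hi ih =>
        intro j hj hij
        have h1 := h.lie_mem (y 1) (by omega) (hc i j hi hj (by omega))
        rw [lie_sub, lie_smul, h.lie_one m (by omega)] at h1
        have h2 := ih (j + 1) (by omega) (by omega)
        rw [h.lie_succ_eq hi hj]
        have e : ⁅y 1, ⁅y i, y j⁆⁆ - ⁅y i, y (j + 1)⁆ -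
            ((-1) ^ (i + 1) * (g - ((i + 1 : ℕ) - 2) * c)) • y (m + 1) =
            (⁅y 1, ⁅y i, y j⁆⁆ - ((-1) ^ i * c) • y (m + 1)) -
            (⁅y i, y (j + 1)⁆ - ((-1) ^ i * (g - (i - 2) * c)) • y (m + 1)) := by
          rw [pow_succ]; push_cast; module
        rw [e]
        exact sub_mem h1 h2
    have hp2 := key (p + 1) (by omega) (p + 1) (by omega) (by omega)
    rw [lie_self, zero_sub, ← neg_smul] at hp2
    have hg0 := h.eq_zero (by omega) (by omega) hp2
    rw [neg_eq_zero, mul_eq_zero, or_iff_right (by simp)] at hg0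
    -- In the Jacobi identity for `y 2`, `y 3`, `y (m - 2)` two terms lie in `F (m + 2)`, and the
    -- third has leading coefficient `-c g`. With `g = (p - 1) c` and `p ≠ 1` this forces `c = 0`.
    have hJ : (c * g) • y (m + 1) ∈ F (m + 2) := by
      have a1 : ⁅y 2, ⁅y 3, y (m - 2)⁆⁆ ∈ F (m + 2) := by
        rw [leibniz_lie]
        refine add_mem ?_ ?_
        · exact h.lie_mem_add (i := 5) (j := m - 2) (by omega) (by omega) (by omega) (by omega)
            h.lie_two_three (h.mem (by omega))
        · have := H 2 (m - 2) le_rfl (by omega) (by omega)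
          rw [show 2 + (m - 2) = m by omega] at this
          exact h.lie_mem_add (i := 3) (j := m) (by omega) (by omega) (by omega) (by omega)
            (h.mem (by omega)) this
      have a2 := h.lie_mem (y 2) (by omega) (hc 3 (m - 2) (by omega) (by omega) (by omega))
      rw [lie_sub, lie_smul] at a2
      have e : (c * g) • y (m + 1) = (⁅y 2, ⁅y 3, y (m - 2)⁆⁆ - ((-1) ^ 3 * c) • ⁅y 2, y m⁆)
          - ⁅y 2, ⁅y 3, y (m - 2)⁆⁆ - c • (⁅y 2, y m⁆ - g • y (m + 1)) := by module
      rw [e]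
      exact sub_mem (sub_mem a2 a1) (Submodule.smul_mem _ _ hg)
    have h0 := h.eq_zero (by omega) (by omega) hJ
    have hg1 : g = ((p : ℂ) - 1) * c := by push_cast at hg0; linear_combination hg0
    rw [hg1] at h0
    have hp1 : (p : ℂ) - 1 ≠ 0 := by
      rw [sub_ne_zero]
      exact_mod_cast (by omega : p ≠ 1)
    simpa [hp1] using h0

/-- The brackets of an adapted basis vanish in the associated graded algebra, except possibly in
the top degree. -/
theorem lie_mem_of_add_le (h : IsAdapted N F y) {i j : ℕ} (hi : 2 ≤ i) (hj : 2 ≤ j)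
    (hij : i + j ≤ N) : ⁅y i, y j⁆ ∈ F (i + j) := by
  have key : ∀ m, 3 ≤ m → m ≤ N →
      ∀ i j, 2 ≤ i → 2 ≤ j → i + j ≤ m → ⁅y i, y j⁆ ∈ F (i + j) := by
    intro m hm
    induction m, hm using Nat.le_induction with
    | base => intros; omega
    | succ m hm ih =>
      intro hmN i j hi hj hij
      have H := ih (by omega)
      rcases hij.eq_or_lt with e | hlt
      swap
      · exact H i j hi hj (by omega)
      obtain ⟨c, hc, hodd⟩ := h.exists_lie_sub_mem hm (by omega) H
      obtain rfl := h.lie_coeff_eq_zero hm hmN H hc hodd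
      have := hc i j hi hj e
      rw [e]
      simpa using this
  exact key N (by omega) le_rfl i j hi hj hij

theorem exists_lie_eq (h : IsAdapted N F y) (hN : 3 ≤ N) :
    ∃ c : ℂ, (∀ i j, 2 ≤ i → 2 ≤ j → i + j = N + 1 → ⁅y i, y j⁆ = ((-1) ^ i * c) • y N) ∧
      (Odd N → c = 0) := by
  obtain ⟨c, hc, hodd⟩ := h.exists_lie_sub_mem hN le_rfl
    fun i j hi hj hij => h.lie_mem_of_add_le hi hj hij
  refine ⟨c, fun i j hi hj hij => ?_, hodd⟩
  have := hc i j hi hj hij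
  rwa [h.bot _ (by omega), Submodule.mem_bot, sub_eq_zero] at this

end IsAdapted

end Adapted

/-! ### Existence of adapted bases -/

section Existence

/-- The chain of length `m + 1` and the vector spanning the chain of length `1`, with the
corresponding coordinates. -/
theorem IsJordanSequence.exists_chain {V : Type*} [AddCommGroup V] [Module ℂ V] {f : End ℂ V}
    {m : ℕ} (h : IsJordanSequence f [m + 1, 1]) :
    ∃ (u : ℕ → V) (v : V) (c : ℕ → V →ₗ[ℂ] ℂ) (d : V →ₗ[ℂ] ℂ),
      (∀ j, f (u j) = u (j + 1)) ∧ u (m + 1) = 0 ∧ f v = 0 ∧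
      (∀ x, x = ∑ j ∈ Finset.range (m + 1), c j x • u j + d x • v) ∧
      ∀ x j, j < m → c (j + 1) (f x) = c j x := by
  obtain ⟨e, he⟩ := h.exists_basis
  let a : Fin (m + 1) → (Σ i : Fin [m + 1, 1].length, Fin ([m + 1, 1].get i)) := fun j => ⟨0, j⟩
  let b : (Σ i : Fin [m + 1, 1].length, Fin ([m + 1, 1].get i)) :=
    ⟨(1 : Fin 2), (0 : Fin 1)⟩
  have ha : Function.Injective a := fun j k hjk => eq_of_heq (Sigma.mk.inj hjk).2
  have hab : ∀ j, a j ≠ b := fun j hj =>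
    absurd (congrArg (fun p => (p.1 : ℕ)) hj) zero_ne_one
  have hcase : ∀ p, (∃ j, p = a j) ∨ p = b := by
    rintro ⟨i, j⟩
    match i, j with
    | ⟨0, _⟩, j => exact Or.inl ⟨j, rfl⟩
    | ⟨1, _⟩, j => exact Or.inr (by
        have : j = (0 : Fin 1) := Subsingleton.elim (α := Fin 1) _ _
        subst this; rfl)
  have hea : ∀ j : Fin (m + 1), f (e (a j)) =
      if hj : (j : ℕ) + 1 < m + 1 then e (a ⟨j + 1, hj⟩) else 0 := fun j => he 0 j
  have heb : f (e b) = 0 := by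
    have := he (1 : Fin 2) (0 : Fin 1)
    simpa using this
  clear_value a b
  refine ⟨fun j => if hj : j < m + 1 then e (a ⟨j, hj⟩) else 0, e b,
    fun j => if hj : j < m + 1 then e.coord (a ⟨j, hj⟩) else 0, e.coord b, ?_, by simp, heb,
    ?_, ?_⟩
  · intro j
    by_cases hj : j < m + 1
    · simp only [hj, dite_true, hea]
    · simp [hj, show ¬ (j < m) by omega]
  · intro x
    have hs := e.sum_repr x
    have huniv : (Finset.univ : Finset (Σ i : Fin [m + 1, 1].length, Fin ([m + 1, 1].get i))) =
        Finset.cons b (Finset.univ.map ⟨a, ha⟩) (by simp [hab]) := by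
      ext p
      rcases hcase p with ⟨j, rfl⟩ | rfl <;> simp
    rw [huniv, Finset.sum_cons, Finset.sum_map] at hs
    rw [Finset.sum_range]
    conv_lhs => rw [← hs, add_comm]
    congr 1
    refine Finset.sum_congr rfl fun j _ => ?_
    simp only [j.2, dite_true]
    rfl
  · intro x j hj
    simp only [show j + 1 < m + 1 by omega, show j < m + 1 by omega, dite_true]
    have : (e.coord (a ⟨j + 1, by omega⟩)).comp f = e.coord (a ⟨j, by omega⟩) := e.ext fun p => by
      rcases hcase p with ⟨k, rfl⟩ | rfl
      · rw [LinearMap.comp_apply, hea]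
        by_cases hk : (k : ℕ) + 1 < m + 1
        · simp only [hk, dite_true, Basis.coord_apply, Basis.repr_self, Finsupp.single_apply,
            ha.eq_iff, Fin.ext_iff, Nat.add_right_cancel_iff]
        · have : (k : ℕ) ≠ j := by omega
          simp [hk, ha.eq_iff, Fin.ext_iff, this]
      · simp [heb, (hab _).symm]
    exact LinearMap.congr_fun this x

theorem isFlagBasis_of_span {V : Type*} [AddCommGroup V] [Module ℂ V] {N : ℕ} {y : ℕ → V}
    (hN : finrank ℂ V = N) (hz : ∀ i, N < i → y i = 0)
    (hs : ⊤ ≤ Submodule.span ℂ (y '' Set.Ici 1)) :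
    IsFlagBasis N (fun i => Submodule.span ℂ (y '' Set.Ici i)) y := by
  have hs' : ⊤ ≤ Submodule.span ℂ (Set.range fun i : Fin N => y (i + 1)) := by
    refine hs.trans (Submodule.span_le.2 ?_)
    rintro _ ⟨l, hl, rfl⟩
    have hl : 1 ≤ l := hl
    rcases Nat.lt_or_ge N l with hlN | hlN
    · rw [hz l hlN]; exact zero_mem _
    · refine Submodule.subset_span ⟨⟨l - 1, by omega⟩, ?_⟩
      simp only
      rw [Nat.sub_add_cancel hl]
  let b := basisOfTopLeSpanOfCardEqFinrank _ hs' (by simp [hN])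
  have hb : ∀ i, b i = y (i + 1) := fun i => by simp [b]
  refine ⟨top_le_iff.1 hs, fun i hi => ?_, hz, fun i hi _ => ?_, fun i hi hiN hmem => ?_⟩
  · rw [Submodule.span_eq_bot]
    rintro _ ⟨l, hl, rfl⟩
    exact hz l (lt_of_lt_of_le hi hl)
  · have : Set.Ici i = insert i (Set.Ici (i + 1)) := by ext l; simp; omega
    rw [this, Set.image_insert_eq, Submodule.span_insert]
  · have hle : Submodule.span ℂ (y '' Set.Ici (i + 1)) ≤
        LinearMap.ker (b.coord ⟨i - 1, by omega⟩) := by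
      rw [Submodule.span_le]
      rintro _ ⟨l, hl, rfl⟩
      have hl : i + 1 ≤ l := hl
      rcases Nat.lt_or_ge N l with hlN | hlN
      · rw [hz l hlN]; exact zero_mem _
      · have e : y l = b ⟨l - 1, by omega⟩ := by
          rw [hb]; simp only; rw [Nat.sub_add_cancel (by omega)]
        rw [SetLike.mem_coe, LinearMap.mem_ker, e, Basis.coord_apply, Basis.repr_self]
        exact Finsupp.single_eq_of_ne (by simp only [ne_eq, Fin.mk.injEq]; omega)
    have h0 := hle hmem
    have e : y i = b ⟨i - 1, by omega⟩ := by
      rw [hb]; simp only; rw [Nat.sub_add_cancel hi]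
    rw [LinearMap.mem_ker, e, Basis.coord_apply, Basis.repr_self] at h0
    simp at h0

variable {L : Type*} [LieRing L] [LieAlgebra ℂ L]

theorem derivedSeries_one_eq :
    derivedSeries ℂ L 1 = LieModule.lowerCentralSeries ℂ L L 1 := by
  rw [derivedSeries_def, derivedSeriesOfIdeal_succ, derivedSeriesOfIdeal_zero,
    LieModule.lowerCentralSeries_succ, LieModule.lowerCentralSeries_zero]

/-- The long Jordan chain `u` of `ad Y`, together with `Y`, is a basis. Subtracting a multiple of
`Y` from `u 0` then normalizes the bracket of `y 2` and `y 3`. -/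
theorem IsFiliform.exists_adapted (h : IsFiliform L) (hN : 3 ≤ finrank ℂ L) :
    ∃ (F : ℕ → Submodule ℂ L) (y : ℕ → L), IsAdapted (finrank ℂ L) F y := by
  obtain ⟨hnil, ⟨Y, hY, hJ⟩, -⟩ := h
  rw [derivedSeries_one_eq] at hY
  obtain ⟨m, hm⟩ : ∃ m, finrank ℂ L = m + 2 := ⟨finrank ℂ L - 2, by omega⟩
  rw [hm, show m + 2 - 1 = m + 1 by omega] at hJ
  obtain ⟨u, v, c, d, hu, hu0, -, hx, hc⟩ := hJ.exists_chain
  simp only [ad_apply] at hu hc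
  have hu0' : ∀ j, m + 1 ≤ j → u j = 0 := fun j hj => by
    induction j, hj using Nat.le_induction with
    | base => exact hu0
    | succ j hj ih => rw [← hu, ih, lie_zero]
  -- Since `ad Y` kills `Y`, only the last chain vector and `v` can occur in `Y`. Without `v`, `Y`
  -- would be a multiple of the last chain vector, which lies in the derived algebra.
  have hd : d Y ≠ 0 := by
    intro hd
    have hYm := hx Y
    rw [hd, zero_smul, add_zero, Finset.sum_range_succ, Finset.sum_eq_zero, zero_add] at hYm
    · apply hY
      obtain ⟨k, rfl⟩ : ∃ k, m = k + 1 := ⟨m - 1, by omega⟩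
      rw [hYm, ← hu]
      exact Submodule.smul_mem _ _ (lie_mem_lowerCentralSeries_succ _ (by simp))
    · intro j hj
      rw [← hc Y j (Finset.mem_range.1 hj), lie_self, map_zero, zero_smul]
  let ys : ℂ → ℕ → L := fun s j => if j = 1 then Y else if j = 2 then u 0 - s • Y else u (j - 2)
  have hys : ∀ s j, 3 ≤ j → ys s j = u (j - 2) := fun s j hj => by
    simp only [ys, show j ≠ 1 by omega, show j ≠ 2 by omega, if_false]
  have h1 : ∀ s, ys s 1 = Y := fun s => rfl
  have h2 : ∀ s, ys s 2 = u 0 - s • Y := fun s => rfl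
  clear_value ys
  have hflag : ∀ s, IsFlagBasis (m + 2) (fun i => Submodule.span ℂ (ys s '' Set.Ici i)) (ys s) := by
    intro s
    refine isFlagBasis_of_span hm (fun i hi => ?_) fun x _ => ?_
    · rw [hys s i (by omega)]; exact hu0' _ (by omega)
    · set S := Submodule.span ℂ (ys s '' Set.Ici 1)
      have hmem : ∀ j, 1 ≤ j → ys s j ∈ S := fun j hj => Submodule.subset_span ⟨j, hj, rfl⟩
      have hYS : Y ∈ S := h1 s ▸ hmem 1 le_rfl
      have huS : ∀ j, u j ∈ S := fun j => by
        rcases Nat.eq_zero_or_pos j with rfl | hj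
        · have := add_mem (hmem 2 (by omega)) (S.smul_mem s hYS)
          rwa [h2, sub_add_cancel] at this
        · have := hmem (j + 2) (by omega)
          rwa [hys _ _ (by omega)] at this
      have hsum : ∀ z, ∑ j ∈ Finset.range (m + 1), c j z • u j ∈ S := fun z =>
        Submodule.sum_mem _ fun j _ => S.smul_mem _ (huS j)
      have hvS : v ∈ S := by
        rw [← S.smul_mem_iff hd]
        have : d Y • v = Y - ∑ j ∈ Finset.range (m + 1), c j Y • u j := by
          rw [eq_sub_iff_add_eq, add_comm]; exact (hx Y).symm
        rw [this]
        exact sub_mem hYS (hsum Y)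
      rw [hx x]
      exact add_mem (hsum x) (S.smul_mem _ hvS)
  have hy : ∀ s j, 2 ≤ j → ⁅ys s 1, ys s j⁆ = ys s (j + 1) := by
    intro s j hj
    rw [h1, hys s (j + 1) (by omega)]
    rcases hj.eq_or_lt with rfl | hj
    · rw [h2, lie_sub, lie_smul, lie_self, smul_zero, sub_zero, hu]
    · rw [hys s j hj, hu]
      congr 1
      omega
  have hl := fun s => (hflag s).lowerCentralSeries_eq (by omega) hnil (by rwa [h1]) (hy s)
  -- The right multiple is the coefficient of `u 2` in the bracket of `u 0` and `u 1`. From the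
  -- third step on the flags for `s = 0` and `s = b` agree, both being given by the lower central
  -- series.
  obtain ⟨b, hb⟩ := (hflag 0).exists_sub_mem (i := 4) (x := ⁅u 0, u 1⁆) (by omega) (by
    rw [← hl 0 1, LieSubmodule.mem_toSubmodule]
    refine lie_mem_lowerCentralSeries_succ _ ?_
    rw [← hu]
    exact lie_mem_lowerCentralSeries_succ _ (by simp))
  rw [← hl 0 2, hys 0 4 (by omega)] at hb
  refine ⟨fun i => Submodule.span ℂ (ys b '' Set.Ici i), ys b, ?_⟩
  rw [hm]
  refine ⟨hflag b, ?_, hy b, ?_⟩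
  · intro x i z hi hz
    rcases hi.eq_or_lt with rfl | hi
    · change ⁅x, z⁆ ∈ Submodule.span ℂ (ys b '' Set.Ici (0 + 3))
      rw [← hl b 0]
      exact lie_mem_lowerCentralSeries_succ _ (by simp)
    · obtain ⟨k, rfl⟩ : ∃ k, i = k + 3 := ⟨i - 3, by omega⟩
      rw [← hl b k] at hz
      rw [add_right_comm, ← hl b (k + 1)]
      exact lie_mem_lowerCentralSeries_succ _ hz
  · rw [← hl b 2, h2, hys b 3 le_rfl, sub_lie, smul_lie, hu]
    exact hb

theorem IsFiliform.two_le_finrank (h : IsFiliform L) : 2 ≤ finrank ℂ L := by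
  obtain ⟨-, ⟨Y, -, hJ⟩, -⟩ := h
  have := hJ.pos (finrank ℂ L - 1) (by simp)
  omega

theorem IsFiliform.isoL_of_finrank_eq_two (h : IsFiliform L) (hN : finrank ℂ L = 2) :
    IsoL L 2 := by
  obtain ⟨-, ⟨Y, hY, hJ⟩, -⟩ := h
  rw [hN] at hJ
  obtain ⟨u, v, c, d, hu, hu0, hv, hx, -⟩ := IsJordanSequence.exists_chain (m := 0) hJ
  simp only [ad_apply] at hu hv
  -- The Jordan type is `(1, 1)`, so `Y` is central; as `Y ≠ 0`, the two-dimensional algebra is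
  -- abelian.
  have hY0 : ∀ x : L, ⁅Y, x⁆ = 0 := fun x => by
    rw [hx x]; simp [hu, hu0, hv]
  have hfin : FiniteDimensional ℂ L := FiniteDimensional.of_finrank_pos (by omega)
  let b := finBasisOfFinrankEq ℂ L hN
  have hYb := b.sum_repr Y
  rw [Fin.sum_univ_two] at hYb
  have e1 := hY0 (b 1)
  have e0 := hY0 (b 0)
  rw [← hYb] at e0 e1
  simp only [add_lie, smul_lie, lie_self, smul_zero, zero_add, add_zero] at e0 e1
  have hb : ⁅b 0, b 1⁆ = 0 := by
    rcases smul_eq_zero.1 e1 with h1 | h1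
    · rcases smul_eq_zero.1 e0 with h0 | h0
      · exfalso
        apply hY
        rw [← hYb, h0, h1]
        simp
      · rw [← lie_skew, h0, neg_zero]
    · exact h1
  refine ⟨b, fun i j hij => ?_⟩
  obtain rfl : i = 0 := by omega
  obtain rfl : j = 1 := by omega
  rw [hb]
  simp [tableL]

end Existence

/-! ### Eigenbases of a semisimple derivation -/

section Eigenbasis

/-- The component `x` of `y` in an invariant complement of `P` is the eigenvector: `f x - a • x`
lies both in `P` and in the complement. -/
theorem exists_eigenvector_sub_mem {V : Type*} [AddCommGroup V] [Module ℂ V] {f : End ℂ V}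
    (hf : f.IsSemisimple) {P Q : Submodule ℂ V} {y : V} (hP : P ≤ P.comap f) (hQ : Q ≤ Q.comap f)
    (hQP : Q = Submodule.span ℂ {y} ⊔ P) : ∃ (x : V) (a : ℂ), x - y ∈ P ∧ f x = a • x := by
  obtain ⟨q, hq, hc⟩ := (End.isSemisimple_iff).1 hf P hP
  obtain ⟨p, hp, x, hx, hpx⟩ := Submodule.mem_sup.1
    (show y ∈ P ⊔ q by rw [hc.sup_eq_top]; trivial)
  have hxy : x - y ∈ P := by
    have : x - y = -p := by rw [← hpx]; abel
    rw [this]; exact neg_mem hp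
  have hyQ : y ∈ Q := hQP ▸ Submodule.mem_sup_left (Submodule.mem_span_singleton_self y)
  have hPQ : P ≤ Q := hQP ▸ le_sup_right
  have hxQ : x ∈ Q := by
    have := add_mem (hPQ hxy) hyQ
    rwa [sub_add_cancel] at this
  have hfx : f x ∈ Submodule.span ℂ {y} ⊔ P := hQP ▸ hQ hxQ
  obtain ⟨u, hu, v, hv, huv⟩ := Submodule.mem_sup.1 hfx
  obtain ⟨a, rfl⟩ := Submodule.mem_span_singleton.1 hu
  refine ⟨x, a, hxy, ?_⟩
  have h1 : f x - a • x ∈ P := by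
    have : f x - a • x = v - a • (x - y) := by rw [← huv, smul_sub]; abel
    rw [this]
    exact sub_mem hv (P.smul_mem a hxy)
  have h2 : f x - a • x ∈ q := sub_mem (hq hx) (q.smul_mem a hx)
  exact sub_eq_zero.1 (Submodule.disjoint_def.1 hc.disjoint _ h1 h2)

variable {L : Type*} [LieRing L] [LieAlgebra ℂ L]

namespace IsAdapted

variable {N : ℕ} {F : ℕ → Submodule ℂ L} {y : ℕ → L}

theorem lie_mem_flag (h : IsAdapted N F y) {i j : ℕ} (hi : 2 ≤ i) (hj : 2 ≤ j) (hij : i + j ≤ N)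
    {x z : L} (hx : x ∈ F i) (hz : z ∈ F j) : ⁅x, z⁆ ∈ F (i + j) := by
  refine h.lie_mem_of_basis (by omega) (by omega) _ (fun i' j' hi' hj' => ?_) hx hz
  rcases Nat.lt_or_ge N (i' + j') with hN | hN
  · exact h.antitone (by omega) (by omega) (h.lie_basis_mem (hi.trans hi') (hj.trans hj'))
  · exact h.antitone (by omega) (by omega)
      (h.lie_mem_of_add_le (hi.trans hi') (hj.trans hj') hN)

theorem lie_eq_zero (h : IsAdapted N F y) {i j : ℕ} (hi : 2 ≤ i) (hj : 2 ≤ j) (hij : N + 2 ≤ i + j)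
    {x z : L} (hx : x ∈ F i) (hz : z ∈ F j) : ⁅x, z⁆ = 0 := by
  have := h.lie_mem_add (m := N + 1) hi hj (by omega) (by omega) hx hz
  rwa [h.bot _ (by omega), Submodule.mem_bot] at this

/-- In the top degree only the leading terms contribute to a bracket. -/
theorem lie_eq_of_sub_mem (h : IsAdapted N F y) {i j : ℕ} (hi : 2 ≤ i) (hj : 2 ≤ j)
    (hij : i + j = N + 1) {x z : L} {a b : ℂ} (hx : x - a • y i ∈ F (i + 1))
    (hz : z - b • y j ∈ F (j + 1)) : ⁅x, z⁆ = (a * b) • ⁅y i, y j⁆ := by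
  have e : ⁅x, z⁆ = (a * b) • ⁅y i, y j⁆ + ⁅x - a • y i, b • y j⁆ +
      ⁅x - a • y i, z - b • y j⁆ + ⁅a • y i, z - b • y j⁆ := by
    simp only [lie_sub, sub_lie, lie_smul, smul_lie, smul_sub]
    module
  have m1 : a • y i ∈ F i := (F i).smul_mem _ (h.mem (by omega))
  have m2 : b • y j ∈ F j := (F j).smul_mem _ (h.mem (by omega))
  rw [e, h.lie_eq_zero (by omega) hj (by omega) hx m2,
    h.lie_eq_zero (by omega) (by omega) (by omega) hx hz,
    h.lie_eq_zero hi (by omega) (by omega) m1 hz]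
  simp

theorem derivation_basis_mem (h : IsAdapted N F y) (D : LieDerivation ℂ L L) {j : ℕ}
    (hj : 3 ≤ j) : D (y j) ∈ F j := by
  induction j, hj using Nat.le_induction with
  | base =>
    rw [← h.lie_one 2 le_rfl, D.apply_lie_eq_add]
    refine add_mem ?_ (h.lie_mem _ le_rfl (h.mem (by omega)))
    obtain ⟨a, ha⟩ := h.exists_sub_mem le_rfl (show D (y 2) ∈ F 1 by rw [h.top]; trivial)
    have := h.lie_mem (y 1) le_rfl ha
    rwa [lie_sub, lie_smul, lie_self, smul_zero, sub_zero] at this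
  | succ j hj ih =>
    rw [← h.lie_one j (by omega), D.apply_lie_eq_add]
    exact add_mem (h.lie_mem _ (by omega) ih) (h.lie_mem _ (by omega) (h.mem (by omega)))

theorem derivation_mem (h : IsAdapted N F y) (hN : 5 ≤ N) (D : LieDerivation ℂ L L) {i : ℕ}
    (hi : 1 ≤ i) : F i ≤ (F i).comap (D : L →ₗ[ℂ] L) := by
  have h3 : ∀ i, 3 ≤ i → F i ≤ (F i).comap (D : L →ₗ[ℂ] L) := fun i hi =>
    h.le_of_forall_mem _ (by omega) fun j hj _ =>
      h.antitone (by omega) hj (h.derivation_basis_mem D (by omega))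
  -- If `a` is the coefficient of `y 1` in `D (y 2)`, applying `D` to the bracket of `y 2` and `y
  -- 3`, which lies in `F 5`, gives `a • y 4 ∈ F 5`. Here `N ≥ 5` puts the other brackets into `F
  -- 5`.
  have h2 : D (y 2) ∈ F 2 := by
    obtain ⟨a, ha⟩ := h.exists_sub_mem le_rfl (show D (y 2) ∈ F 1 by rw [h.top]; trivial)
    have m1 : D ⁅y 2, y 3⁆ ∈ F 5 := h3 5 (by omega) h.lie_two_three
    have m2 := h.lie_mem_flag (i := 2) (j := 3) le_rfl (by omega) hN ha (h.mem (by omega))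
    have m3 := h.lie_mem_flag (i := 2) (j := 3) le_rfl (by omega) hN (h.mem (by omega))
      (h.derivation_basis_mem D le_rfl)
    rw [sub_lie, smul_lie, h.lie_one 3 (by omega)] at m2
    have e : a • y 4 = D ⁅y 2, y 3⁆ - ⁅y 2, D (y 3)⁆ - (⁅D (y 2), y 3⁆ - a • y (3 + 1)) := by
      rw [D.apply_lie_eq_add]; abel
    have m4 : a • y 4 ∈ F 5 := by
      rw [e]
      exact sub_mem (sub_mem m1 m3) m2
    rw [h.eq_zero (by omega) (by omega) m4, zero_smul, sub_zero] at ha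
    exact ha
  rcases Nat.lt_or_ge i 3 with hi3 | hi3
  · obtain rfl | rfl : i = 1 ∨ i = 2 := by omega
    · rw [h.top]; exact le_top
    · refine h.le_of_forall_mem _ (by omega) fun j hj _ => ?_
      rcases hj.eq_or_lt with rfl | hj
      · exact h2
      · exact h.antitone (by omega) hj.le (h.derivation_basis_mem D hj)
  · exact h3 i hi3

end IsAdapted

/-- An adapted basis made of eigenvectors of a derivation `D`, apart from the brackets in the top
degree. -/
structure IsEigenBasis (D : LieDerivation ℂ L L) (N : ℕ) (F : ℕ → Submodule ℂ L) (X : ℕ → L)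
    (α β : ℂ) : Prop extends IsFlagBasis N F X where
  eigen_one : D (X 1) = α • X 1
  eigen : ∀ j, 2 ≤ j → j < N → D (X j) = (β + (j - 2) * α) • X j
  lie_one : ∀ j, 2 ≤ j → j + 1 < N → ⁅X 1, X j⁆ = X (j + 1)
  lie_one_top : ⁅X 1, X N⁆ = 0
  lie_mem : ∀ i j, 2 ≤ i → 2 ≤ j → i + j ≤ N → ⁅X i, X j⁆ ∈ F (i + j)
  lie_zero : ∀ i j, 2 ≤ i → 2 ≤ j → N + 2 ≤ i + j → ⁅X i, X j⁆ = 0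

/-- An eigenbasis whose associated graded algebra is that of `L_N`. -/
structure IsEigenBasisL (D : LieDerivation ℂ L L) (N : ℕ) (F : ℕ → Submodule ℂ L) (X : ℕ → L)
    (α β c : ℂ) : Prop extends IsEigenBasis D N F X α β where
  lie_one_last : ⁅X 1, X (N - 1)⁆ = X N
  eigen_top : D (X N) = (β + (N - 2) * α) • X N
  lie_top : ∀ i j, 2 ≤ i → 2 ≤ j → i + j = N + 1 → ⁅X i, X j⁆ = ((-1) ^ i * c) • X N
  odd : Odd N → c = 0

/-- An eigenbasis whose associated graded algebra is that of `Q_N`. -/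
structure IsEigenBasisQ (D : LieDerivation ℂ L L) (N : ℕ) (F : ℕ → Submodule ℂ L) (X : ℕ → L)
    (α β : ℂ) : Prop extends IsEigenBasis D N F X α β where
  lie_one_last : ⁅X 1, X (N - 1)⁆ = 0
  eigen_top : D (X N) = (2 * β + (N - 3) * α) • X N
  lie_top : ∀ i j, 2 ≤ i → 2 ≤ j → i + j = N + 1 → ⁅X i, X j⁆ = (-1 : ℂ) ^ (i + 1) • X N
  even : Even N

/-- The vectors `Z j` obtained from `X₂` by iterating `ad X₁` are eigenvectors with the leading
terms of `y j` for `j < N`. Whether `Z N` vanishes decides between the two graded types. -/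
theorem IsAdapted.exists_eigenbasis {N : ℕ} {F : ℕ → Submodule ℂ L} {y : ℕ → L}
    (h : IsAdapted N F y) (hN : 5 ≤ N) (D : LieDerivation ℂ L L)
    (hD : End.IsSemisimple (D : L →ₗ[ℂ] L)) :
    (∃ X α β c, IsEigenBasisL D N F X α β c) ∨ ∃ X α β, IsEigenBasisQ D N F X α β := by
  obtain ⟨X₁, α, hX₁, hα⟩ := exists_eigenvector_sub_mem hD (h.derivation_mem hN D (i := 2)
    (by omega)) (h.derivation_mem hN D le_rfl) (h.step 1 le_rfl (by omega))
  obtain ⟨X₂, β, hX₂, hβ⟩ := exists_eigenvector_sub_mem hD (h.derivation_mem hN D (i := 3)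
    (by omega)) (h.derivation_mem hN D (i := 2) (by omega)) (h.step 2 (by omega) (by omega))
  rw [LieDerivation.coeFn_coe] at hα hβ
  obtain ⟨s, hs⟩ := h.exists_sub_mem (by omega) hX₁
  obtain ⟨c, hc, hodd⟩ := h.exists_lie_eq (by omega)
  let Z : ℕ → L := fun j => (fun x => ⁅X₁, x⁆)^[j - 2] X₂
  have hZ2 : Z 2 = X₂ := rfl
  have hZs : ∀ j, 2 ≤ j → ⁅X₁, Z j⁆ = Z (j + 1) := fun j hj => by
    simp only [Z]
    rw [show j + 1 - 2 = (j - 2) + 1 by omega, Function.iterate_succ_apply']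
  clear_value Z
  have hZ : ∀ j, 2 ≤ j → j < N → Z j - y j ∈ F (j + 1) := by
    intro j hj
    induction j, hj using Nat.le_induction with
    | base => intro _; rw [hZ2]; exact hX₂
    | succ j hj ih =>
      intro hjN
      have e : Z (j + 1) - y (j + 1) = ⁅X₁, Z j - y j⁆ + ⁅X₁ - y 1, y j⁆ := by
        rw [← hZs j hj, ← h.lie_one j hj, lie_sub, sub_lie]; abel
      rw [e]
      refine add_mem (h.lie_mem _ (by omega) (ih (by omega))) ?_
      have := h.lie_mem_flag (i := 2) (j := j) le_rfl hj (by omega) hX₁ (h.mem (by omega))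
      rwa [show 2 + j = j + 1 + 1 by omega] at this
  -- The correction `s * c` comes from the `y 2`-term of `X₁`, bracketed with `y (N - 1)`.
  have hZN : Z N = (1 + s * c) • y N := by
    obtain ⟨M, rfl⟩ : ∃ M, N = M + 1 := ⟨N - 1, by omega⟩
    have e : Z (M + 1) = y (M + 1) + ⁅X₁, Z M - y M⁆ + ⁅X₁ - y 1, y M⁆ := by
      rw [← hZs M (by omega), ← h.lie_one M (by omega), lie_sub, sub_lie]; abel
    have e1 := h.lie_mem X₁ (by omega) (hZ M (by omega) (by omega))
    rw [h.bot _ (by omega), Submodule.mem_bot] at e1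
    have e2 := h.lie_eq_of_sub_mem (i := 2) (j := M) (x := X₁ - y 1) (z := y M) (a := s) (b := 1)
      le_rfl (by omega) (by omega) hs (by simp)
    rw [hc 2 M le_rfl (by omega) (by omega)] at e2
    rw [e, e1, e2, add_zero, smul_smul]
    module
  have hZmem : ∀ j, 2 ≤ j → j < N → Z j ∈ F j := fun j hj hjN => by
    have := add_mem (h.succ_le (by omega) (hZ j hj hjN)) (h.mem (i := j) (by omega))
    rwa [sub_add_cancel] at this
  have hZnm : ∀ j, 2 ≤ j → j < N → Z j ∉ F (j + 1) := fun j hj hjN hm => by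
    have := sub_mem hm (hZ j hj hjN)
    rw [sub_sub_cancel] at this
    exact h.notMem j (by omega) (by omega) this
  have hX₁nm : X₁ ∉ F 2 := fun hm => by
    have := sub_mem hm hX₁
    rw [sub_sub_cancel] at this
    exact h.notMem 1 le_rfl (by omega) this
  have hZD : ∀ j, 2 ≤ j → D (Z j) = (β + (j - 2) * α) • Z j := fun j hj => by
    induction j, hj using Nat.le_induction with
    | base => rw [hZ2, hβ]; norm_num
    | succ j hj ih =>
      rw [← hZs j hj, D.apply_lie_eq_add, ih, hα, lie_smul, smul_lie]
      push_cast
      module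
  have hZlie : ∀ i j, 2 ≤ i → 2 ≤ j → i + j = N + 1 → ⁅Z i, Z j⁆ = ((-1) ^ i * c) • y N :=
    fun i j hi hj hij => by
      rw [h.lie_eq_of_sub_mem (x := Z i) (z := Z j) (a := 1) (b := 1) hi hj hij
        (by simpa using hZ i hi (by omega)) (by simpa using hZ j hj (by omega)),
        hc i j hi hj hij, one_mul, one_smul]
  have hyN : ∀ x, ⁅x, y N⁆ = 0 := fun x => by
    have := h.lie_mem x (by omega) (h.mem (i := N) (by omega))
    rwa [h.bot _ (by omega), Submodule.mem_bot] at this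
  have hbr : ∀ X : ℕ → L, (∀ j, 2 ≤ j → X j ∈ F j) →
      (∀ i j, 2 ≤ i → 2 ≤ j → i + j ≤ N → ⁅X i, X j⁆ ∈ F (i + j)) ∧
      (∀ i j, 2 ≤ i → 2 ≤ j → N + 2 ≤ i + j → ⁅X i, X j⁆ = 0) := fun X hX =>
    ⟨fun i j hi hj hij => h.lie_mem_flag hi hj hij (hX i hi) (hX j hj),
      fun i j hi hj hij => h.lie_eq_zero hi hj hij (hX i hi) (hX j hj)⟩
  -- the basis obtained by choosing a multiple of `y N` as last vector
  have main : ∀ r : ℂ, r ≠ 0 → ∃ X : ℕ → L, (X 1 = X₁) ∧ (∀ j, 2 ≤ j → j < N → X j = Z j) ∧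
      X N = r • y N ∧ IsEigenBasis D N F X α β := by
    intro r hr
    let X : ℕ → L := fun j => if j = 1 then X₁ else if j < N then Z j else
      if j = N then r • y N else 0
    have h1 : X 1 = X₁ := rfl
    have h2 : ∀ j, 2 ≤ j → j < N → X j = Z j := fun j hj hjN => by
      simp only [X, show j ≠ 1 by omega, hjN, if_true, if_false]
    have h3 : X N = r • y N := by
      simp only [X, show N ≠ 1 by omega, lt_irrefl, if_true, if_false]
    have h4 : ∀ j, N < j → X j = 0 := fun j hj => by
      simp only [X, show j ≠ 1 by omega, show ¬ j < N by omega, show j ≠ N by omega, if_false]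
    clear_value X
    have hm : ∀ j, 2 ≤ j → X j ∈ F j := fun j hj => by
      rcases lt_trichotomy j N with hjN | rfl | hjN
      · rw [h2 j hj hjN]; exact hZmem j hj hjN
      · rw [h3]; exact (F j).smul_mem _ (h.mem (by omega))
      · rw [h4 j hjN]; exact zero_mem _
    refine ⟨X, h1, h2, h3, ?_, by rw [h1, hα], ?_, ?_, ?_, (hbr X hm).1, (hbr X hm).2⟩
    · refine h.of_mem (fun j hj hjN => ?_) (fun j hj hjN => ?_) h4
      · rcases hj.eq_or_lt with rfl | hj
        · rw [h.top]; trivial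
        · exact hm j hj
      · rcases hj.eq_or_lt with rfl | hj
        · rw [h1]; exact hX₁nm
        · rcases hjN.eq_or_lt with rfl | hjN
          · rw [h3, Submodule.smul_mem_iff _ hr]
            exact h.notMem j (by omega) le_rfl
          · rw [h2 j hj hjN]; exact hZnm j hj hjN
    · intro j hj hjN
      rw [h2 j hj hjN, hZD j hj]
    · intro j hj hjN
      rw [h1, h2 j hj (by omega), h2 (j + 1) (by omega) hjN, hZs j hj]
    · rw [h3, lie_smul, hyN, smul_zero]
  by_cases hsc : 1 + s * c = 0
  · have hc0 : c ≠ 0 := by rintro rfl; simp at hsc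
    -- The factor `-c` turns the top brackets `(-1)^i c • y N` into `(-1)^(i+1) • X N`.
    obtain ⟨X, h1, h2, h3, hX⟩ := main (-c) (neg_ne_zero.2 hc0)
    refine Or.inr ⟨X, α, β, hX, ?_, ?_, fun i j hi hj hij => ?_, ?_⟩
    · rw [h1, h2 (N - 1) (by omega) (by omega), hZs (N - 1) (by omega),
        Nat.sub_add_cancel (by omega), hZN, hsc, zero_smul]
    · have e := hZlie 2 (N - 1) le_rfl (by omega) (by omega)
      have e' : X N = -⁅Z 2, Z (N - 1)⁆ := by rw [h3, e]; module
      rw [e', map_neg, D.apply_lie_eq_add, hZD _ le_rfl, hZD (N - 1) (by omega), lie_smul,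
        smul_lie, Nat.cast_sub (by omega)]
      push_cast
      module
    · rw [h2 i hi (by omega), h2 j hj (by omega), hZlie i j hi hj hij, h3, smul_smul]
      congr 1
      ring
    · by_contra hodd'
      exact hc0 (hodd (Nat.not_even_iff_odd.1 hodd'))
  · obtain ⟨X, h1, h2, h3, hX⟩ := main (1 + s * c) hsc
    rw [← hZN] at h3
    refine Or.inl ⟨X, α, β, c / (1 + s * c), hX, ?_, ?_, fun i j hi hj hij => ?_, fun ho => ?_⟩
    · rw [h1, h2 (N - 1) (by omega) (by omega), hZs (N - 1) (by omega),
        Nat.sub_add_cancel (by omega), h3]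
    · rw [h3, hZD N (by omega)]
    · rw [h2 i hi (by omega), h2 j hj (by omega), hZlie i j hi hj hij, h3, hZN, smul_smul,
        mul_assoc, div_mul_cancel₀ _ hsc]
    · rw [hodd ho, zero_div]

end Eigenbasis

/-! ### Structure constants and weights -/

section Coordinates

theorem IsFlagBasis.exists_coord {V : Type*} [AddCommGroup V] [Module ℂ V] {N : ℕ}
    {F : ℕ → Submodule ℂ V} {X : ℕ → V} (h : IsFlagBasis N F X) (hN : finrank ℂ V = N) :
    ∃ (b : Basis (Fin N) ℂ V) (co : ℕ → V →ₗ[ℂ] ℂ), (∀ i : Fin N, b i = X (i + 1)) ∧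
      (∀ (l : Fin N) x, b.repr x l = co (l + 1) x) ∧
      (∀ l m, 1 ≤ l → l ≤ N → 1 ≤ m → co l (X m) = if l = m then 1 else 0) ∧
      ∀ l i x, 1 ≤ i → l < i → x ∈ F i → co l x = 0 := by
  obtain ⟨b, hb⟩ := h.exists_basis hN
  refine ⟨b, fun l => if hl : 1 ≤ l ∧ l ≤ N then b.coord ⟨l - 1, by omega⟩ else 0, hb,
    fun l x => ?_, fun l m hl hlN hm => ?_, fun l i x hi hli hx => ?_⟩
  · simp [show (l : ℕ) + 1 ≤ N by omega]
  · simp only [hl, hlN, and_self, dite_true]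
    rcases Nat.lt_or_ge N m with hmN | hmN
    · rw [h.zero m hmN, map_zero, if_neg (by omega)]
    · have : X m = b ⟨m - 1, by omega⟩ := by
        rw [hb]; simp only; rw [Nat.sub_add_cancel hm]
      rw [this, Basis.coord_apply, Basis.repr_self, Finsupp.single_apply]
      simp only [Fin.mk.injEq]
      refine if_congr (by omega) rfl rfl
  · by_cases hl : 1 ≤ l ∧ l ≤ N
    · simp only [hl, and_self, dite_true]
      exact h.repr_eq_zero b hb hi hx _ (by simp only; omega)
    · simp only [hl, dite_false, LinearMap.zero_apply]

variable {L : Type*} [LieRing L] [LieAlgebra ℂ L]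

/-- A family of coordinate functionals for the basis `X 1, …, X N`. -/
structure IsCoord (N : ℕ) (F : ℕ → Submodule ℂ L) (X : ℕ → L) (co : ℕ → L →ₗ[ℂ] ℂ) : Prop
    extends IsFlagBasis N F X where
  apply_basis : ∀ l m, 1 ≤ l → l ≤ N → 1 ≤ m → co l (X m) = if l = m then 1 else 0
  eq_zero_of_mem : ∀ l i x, 1 ≤ i → l < i → x ∈ F i → co l x = 0
  hasTable : ∀ c : ℕ → ℕ → ℕ → ℂ, (∀ i j l, 1 ≤ i → i < j → j ≤ N → 1 ≤ l → l ≤ N →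
    co l ⁅X i, X j⁆ = c i j l) → HasTable L N c

theorem IsFlagBasis.exists_isCoord {N : ℕ} {F : ℕ → Submodule ℂ L} {X : ℕ → L}
    (h : IsFlagBasis N F X) (hN : finrank ℂ L = N) : ∃ co, IsCoord N F X co := by
  obtain ⟨b, co, hb, hco, h1, h2⟩ := h.exists_coord hN
  refine ⟨co, h, h1, h2, fun c hc => hasTable_iff.2 ⟨b, fun i j hij l => ?_⟩⟩
  rw [hco, hb, hb]
  exact hc _ _ _ (by omega) (by simpa using hij) (by omega) (by omega) (by omega)

namespace IsCoord

variable {N : ℕ} {F : ℕ → Submodule ℂ L} {X : ℕ → L} {co : ℕ → L →ₗ[ℂ] ℂ}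

theorem linearMap_ext (h : IsCoord N F X co) {W : Type*} [AddCommGroup W] [Module ℂ W]
    {f g : L →ₗ[ℂ] W} (hfg : ∀ m, 1 ≤ m → m ≤ N → f (X m) = g (X m)) : f = g := by
  have : F 1 ≤ LinearMap.eqLocus f g := h.le_of_forall_mem _ le_rfl fun j h1 h2 => hfg j h1 h2
  rw [h.top, top_le_iff, LinearMap.eqLocus_eq_top] at this
  exact this

theorem apply_derivation (h : IsCoord N F X co) (D : LieDerivation ℂ L L) (w : ℕ → ℂ)
    (hw : ∀ m, 1 ≤ m → m ≤ N → D (X m) = w m • X m) {l : ℕ} (hl : 1 ≤ l) (hlN : l ≤ N) (x : L) :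
    co l (D x) = w l * co l x := by
  have : (co l).comp (D : L →ₗ[ℂ] L) = w l • co l := h.linearMap_ext fun m h1 h2 => by
    rw [LinearMap.comp_apply, LieDerivation.coeFn_coe, hw m h1 h2, map_smul,
      LinearMap.smul_apply, h.apply_basis l m hl hlN h1]
    split_ifs with hlm
    · rw [hlm]
    · simp
  exact LinearMap.congr_fun this x

theorem weight_eq (h : IsCoord N F X co) (D : LieDerivation ℂ L L) (w : ℕ → ℂ)
    (hw : ∀ m, 1 ≤ m → m ≤ N → D (X m) = w m • X m) {i j l : ℕ} (hi : 1 ≤ i) (hiN : i ≤ N)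
    (hj : 1 ≤ j) (hjN : j ≤ N) (hl : 1 ≤ l) (hlN : l ≤ N) (hne : co l ⁅X i, X j⁆ ≠ 0) :
    w l = w i + w j := by
  have e := h.apply_derivation D w hw hl hlN ⁅X i, X j⁆
  rw [D.apply_lie_eq_add, hw i hi hiN, hw j hj hjN, lie_smul, smul_lie, map_add, map_smul,
    map_smul, smul_eq_mul, smul_eq_mul] at e
  refine mul_right_cancel₀ hne ?_
  linear_combination -e

theorem eq_smul (h : IsCoord N F X co) {x : L} {m : ℕ} (hm : 1 ≤ m)
    (hx : ∀ l, 1 ≤ l → l ≤ N → l ≠ m → co l x = 0) : x = co m x • X m := by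
  have key : ∀ i, 1 ≤ i → i ≤ N + 1 → x - co m x • X m ∈ F i := by
    intro i hi
    induction i, hi using Nat.le_induction with
    | base => intro _; rw [h.top]; trivial
    | succ i hi ih =>
      intro hiN
      obtain ⟨a, ha⟩ := h.exists_sub_mem hi (ih (by omega))
      have h0 := h.eq_zero_of_mem i (i + 1) _ (by omega) (by omega) ha
      have hz : co i (x - co m x • X m) = 0 := by
        rw [map_sub, map_smul, h.apply_basis i m hi (by omega) hm, smul_eq_mul]
        split_ifs with him
        · rw [him]; ring
        · rw [hx i hi (by omega) him]; ring
      rw [map_sub, hz, map_smul, h.apply_basis i i hi (by omega) hi] at h0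
      have ha0 : a = 0 := by simpa using h0
      simpa [ha0] using ha
  have := key (N + 1) (by omega) le_rfl
  rw [h.bot _ (by omega), Submodule.mem_bot] at this
  exact sub_eq_zero.1 this

/-- The coordinates of the brackets satisfy the recursion that defines `coefGap`. -/
theorem coord_lie_eq_coefGap (h : IsCoord N F X co) {M k : ℕ} (hM : M ≤ N)
    (h1 : ∀ j, 2 ≤ j → j < M → ⁅X 1, X j⁆ = X (j + 1))
    (h0 : ∀ j, M ≤ j → j ≤ N → ⁅X 1, X j⁆ = 0) (d i : ℕ) (hi : 2 ≤ i)
    (hd : 2 * i + d + k ≤ M + 2) :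
    co (2 * i + d + k - 2) ⁅X i, X (i + d)⁆ =
      coefGap (fun s => co (2 * s + 1 + k) ⁅X (s + 1), X (s + 2)⁆) d i := by
  induction d using Nat.strong_induction_on generalizing i with
  | _ d ih =>
    match d with
    | 0 => simp [coefGap]
    | 1 =>
      obtain ⟨s, rfl⟩ : ∃ s, i = s + 1 := ⟨i - 1, by omega⟩
      simp only [coefGap, Nat.add_sub_cancel]
      congr 2
      omega
    | d + 2 =>
      -- `ad (X 1)` shifts coordinates by one up to index `M`, which is `N` for type `L` and `N - 1`
      -- for type `Q`. Evaluated on a bracket, this is the recursion of the `a_ij`.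
      have hshift : ∀ x, co (2 * i + d + k) ⁅X 1, x⁆ = co (2 * i + d + k - 1) x := by
        intro x
        have : (co (2 * i + d + k)).comp (ad ℂ L (X 1) : L →ₗ[ℂ] L) =
            co (2 * i + d + k - 1) := h.linearMap_ext fun m hm hmN => by
          rw [LinearMap.comp_apply, ad_apply, h.apply_basis _ m (by omega) (by omega) hm]
          rcases hm.eq_or_lt with rfl | hm2
          · rw [lie_self, map_zero, if_neg (by omega)]
          · rcases Nat.lt_or_ge m M with hmM | hmM
            · rw [h1 m hm2 hmM, h.apply_basis _ (m + 1) (by omega) (by omega) (by omega)]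
              exact if_congr (by omega) rfl rfl
            · rw [h0 m hmM hmN, map_zero, if_neg (by omega)]
        exact LinearMap.congr_fun this x
      have e := hshift ⁅X i, X (i + (d + 1))⁆
      rw [leibniz_lie, h1 i hi (by omega), h1 (i + (d + 1)) (by omega) (by omega), map_add] at e
      have i1 := ih (d + 1) (by omega) i hi (by omega)
      have i2 := ih d (by omega) (i + 1) (by omega) (by omega)
      rw [show 2 * i + (d + 1) + k - 2 = 2 * i + d + k - 1 by omega] at i1
      rw [show 2 * (i + 1) + d + k - 2 = 2 * i + d + k by omega,
        show i + 1 + d = i + (d + 1) by omega] at i2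
      rw [i1, i2] at e
      rw [coefGap, ← e, add_sub_cancel_left, show 2 * i + (d + 2) + k - 2 = 2 * i + d + k by omega]
      rfl

end IsCoord

/-- The recursion never increases `2 * i + d`, so only the parameters `lam s` with `2 * s + 3 ≤ 2 *
i + d` enter. A nonzero bracket thus exhibits a nonzero parameter in the admissible range. -/
theorem coefGap_eq_zero {lam : ℕ → ℂ} {S : ℕ} (h : ∀ s, 1 ≤ s → s ≤ S → lam s = 0) (d i : ℕ)
    (hi : 2 ≤ i) (hd : 2 * i + d ≤ 2 * S + 4) : coefGap lam d i = 0 := by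
  induction d using Nat.strong_induction_on generalizing i with
  | _ d ih =>
    match d with
    | 0 => rfl
    | 1 => exact h _ (by omega) (by omega)
    | d + 2 =>
      rw [coefGap, ih (d + 1) (by omega) i hi (by omega), ih d (by omega) (i + 1) (by omega)
        (by omega), sub_zero]

end Coordinates

/-! ### Identification of the families by weights -/

section Classification

variable {L : Type*} [LieRing L] [LieAlgebra ℂ L] {N : ℕ} {F : ℕ → Submodule ℂ L} {X : ℕ → L}

theorem exists_coef_ne_zero {lam : ℕ → ℂ} {S d i : ℕ} (hi : 2 ≤ i) (hd : 2 * i + d ≤ 2 * S + 4)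
    (h : coefGap lam d i ≠ 0) : ∃ s, 1 ≤ s ∧ s ≤ S ∧ lam s ≠ 0 := by
  by_contra! hc
  exact h (coefGap_eq_zero hc d i hi hd)

theorem IsCoord.isoL {co : ℕ → L →ₗ[ℂ] ℂ} (h : IsCoord N F X co)
    (h1 : ∀ j, 2 ≤ j → j ≤ N → ⁅X 1, X j⁆ = X (j + 1))
    (h0 : ∀ i j l, 2 ≤ i → i < j → j ≤ N → 1 ≤ l → l ≤ N → co l ⁅X i, X j⁆ = 0) : IsoL L N := by
  refine h.hasTable _ fun i j l hi hij hj hl hlN => ?_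
  unfold tableL
  rcases hi.eq_or_lt with rfl | hi
  · rw [h1 j (by omega) hj, h.apply_basis l (j + 1) hl hlN (by omega)]
    simp
  · rw [h0 i j l hi hij hj hl hlN, if_neg (by omega)]

/-- Scaling all vectors but the first by `-c⁻¹` keeps the action of `X 1` and normalizes the top
brackets. -/
theorem IsCoord.isoQ_of_lie_top {co : ℕ → L →ₗ[ℂ] ℂ} (h : IsCoord N F X co)
    (hfin : finrank ℂ L = N) (hN : Even N)
    (h1 : ∀ j, 2 ≤ j → j ≤ N → ⁅X 1, X j⁆ = X (j + 1)) {c : ℂ} (hc : c ≠ 0)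
    (htop : ∀ i j, 2 ≤ i → 2 ≤ j → i + j = N + 1 → ⁅X i, X j⁆ = ((-1) ^ i * c) • X N)
    (h0 : ∀ i j, 2 ≤ i → i < j → j ≤ N → i + j ≠ N + 1 → ⁅X i, X j⁆ = 0) : IsoQ L N := by
  let Z : ℕ → L := fun j => if j = 1 then X 1 else (-c⁻¹) • X j
  have hZ1 : Z 1 = X 1 := rfl
  have hZ : ∀ j, 2 ≤ j → Z j = (-c⁻¹) • X j := fun j hj => by
    simp only [Z, show j ≠ 1 by omega, if_false]
  clear_value Z
  have hc' : -c⁻¹ ≠ 0 := neg_ne_zero.2 (inv_ne_zero hc)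
  have hflag : IsFlagBasis N F Z := by
    refine h.of_mem (fun i hi hiN => ?_) (fun i hi hiN => ?_) fun i hi => ?_
    · rcases hi.eq_or_lt with rfl | hi
      · rw [hZ1]; exact h.mem le_rfl
      · rw [hZ i hi]; exact (F i).smul_mem _ (h.mem (by omega))
    · rcases hi.eq_or_lt with rfl | hi
      · rw [hZ1]; exact h.notMem 1 le_rfl hiN
      · rw [hZ i hi, Submodule.smul_mem_iff _ hc']; exact h.notMem i (by omega) hiN
    · rcases Nat.lt_or_ge i 2 with hi2 | hi2
      · obtain rfl : N = 0 := by obtain ⟨r, rfl⟩ := hN; omega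
        obtain rfl : i = 1 := by omega
        rw [hZ1, h.zero _ hi]
      · rw [hZ i hi2, h.zero i hi, smul_zero]
  obtain ⟨co', h'⟩ := hflag.exists_isCoord hfin
  refine ⟨hN, h'.hasTable _ fun i j l hi hij hj hl hlN => ?_⟩
  unfold tableQ
  rcases hi.eq_or_lt with rfl | hi
  · rw [hZ1, hZ j (by omega), lie_smul, h1 j (by omega) hj, ← hZ (j + 1) (by omega),
      h'.apply_basis l (j + 1) hl hlN (by omega), if_pos rfl]
  · rw [if_neg (by omega), hZ i hi, hZ j (by omega), lie_smul, smul_lie]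
    by_cases hij' : i + j = N + 1
    · have e : (-c⁻¹) • (-c⁻¹) • ⁅X i, X j⁆ = (-1 : ℂ) ^ (i + 1) • Z N := by
        rw [htop i j hi (by omega) hij', hZ N (by omega), smul_smul, smul_smul, smul_smul]
        congr 1
        field_simp
        ring
      rw [e, map_smul, h'.apply_basis l N hl hlN (by omega)]
      simp [hij']
    · rw [h0 i j hi hij hj hij']
      simp [hij']

theorem IsEigenBasisL.classify {D : LieDerivation ℂ L L} {α β c : ℂ}
    (h : IsEigenBasisL D N F X α β c) (hfin : finrank ℂ L = N) (hN : 5 ≤ N)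
    (hαβ : α ≠ 0 ∨ β ≠ 0) : IsoL L N ∨ IsoQ L N ∨ ∃ k lam, IsoA L N k lam := by
  obtain ⟨co, hco⟩ := h.exists_isCoord hfin
  let w : ℕ → ℂ := fun l => if l = 1 then α else β + (l - 2) * α
  have hw1 : w 1 = α := rfl
  have hw2 : ∀ l, 2 ≤ l → w l = β + (l - 2) * α := fun l hl => by
    simp only [w, show l ≠ 1 by omega, if_false]
  clear_value w
  have hw : ∀ m, 1 ≤ m → m ≤ N → D (X m) = w m • X m := fun m hm hmN => by
    rcases hm.eq_or_lt with rfl | hm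
    · rw [hw1, h.eigen_one]
    · rw [hw2 m hm]
      rcases hmN.eq_or_lt with rfl | hmN
      · exact h.eigen_top
      · exact h.eigen m hm hmN
  have h1 : ∀ j, 2 ≤ j → j ≤ N → ⁅X 1, X j⁆ = X (j + 1) := fun j hj hjN => by
    rcases hjN.eq_or_lt with rfl | hjN
    · rw [h.lie_one_top, h.zero _ (by omega)]
    · rcases Nat.lt_or_ge (j + 1) N with hj1 | hj1
      · exact h.lie_one j hj hj1
      · obtain rfl : N = j + 1 := by omega
        exact h.lie_one_last
  have hle : ∀ i j l, 2 ≤ i → 2 ≤ j → 1 ≤ l → l ≤ N → co l ⁅X i, X j⁆ ≠ 0 →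
      i + j ≤ l ∨ (i + j = N + 1 ∧ l = N) := by
    intro i j l hi hj hl hlN hne
    rcases lt_trichotomy (i + j) (N + 1) with hij | hij | hij
    · left
      by_contra hlt
      exact hne (hco.eq_zero_of_mem l (i + j) _ (by omega) (by omega)
        (h.lie_mem i j hi hj (by omega)))
    · right
      refine ⟨hij, ?_⟩
      by_contra hlN'
      apply hne
      rw [h.lie_top i j hi hj hij, map_smul, hco.apply_basis l N hl hlN (by omega), if_neg hlN',
        smul_zero]
    · rw [h.lie_zero i j hi hj (by omega), map_zero] at hne
      exact absurd rfl hne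
  by_cases hall : ∀ i j l, 2 ≤ i → i < j → j ≤ N → 1 ≤ l → l ≤ N → co l ⁅X i, X j⁆ = 0
  · exact Or.inl (hco.isoL h1 hall)
  push Not at hall
  obtain ⟨i₀, j₀, l₀, hi₀, hij₀, hj₀, hl₀, hlN₀, hne₀⟩ := hall
  have hwt : ∀ i j l, 2 ≤ i → i ≤ N → 2 ≤ j → j ≤ N → 1 ≤ l → l ≤ N → co l ⁅X i, X j⁆ ≠ 0 →
      β = ((l : ℂ) + 2 - i - j) * α := by
    intro i j l hi hiN hj hjN hl hlN hne
    have e := hco.weight_eq D w hw (by omega) hiN (by omega) hjN hl hlN hne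
    have := hle i j l hi hj hl hlN hne
    rw [hw2 l (by omega), hw2 i hi, hw2 j hj] at e
    linear_combination -e
  obtain ⟨k, hk⟩ : ∃ k, l₀ + 2 = i₀ + j₀ + k := by
    have := hle i₀ j₀ l₀ hi₀ (by omega) hl₀ hlN₀ hne₀
    exact ⟨l₀ + 2 - i₀ - j₀, by omega⟩
  have hβ : β = k * α := by
    rw [hwt i₀ j₀ l₀ hi₀ (by omega) (by omega) hj₀ hl₀ hlN₀ hne₀]
    have : (l₀ : ℂ) + 2 = i₀ + j₀ + k := by exact_mod_cast hk
    rw [this]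
    ring
  have hα : α ≠ 0 := by
    rintro rfl
    rw [mul_zero] at hβ
    simp [hβ] at hαβ
  have hl : ∀ i j l, 2 ≤ i → i ≤ N → 2 ≤ j → j ≤ N → 1 ≤ l → l ≤ N → co l ⁅X i, X j⁆ ≠ 0 →
      l + 2 = i + j + k := by
    intro i j l hi hiN hj hjN hl hlN hne
    have e := hwt i j l hi hiN hj hjN hl hlN hne
    rw [hβ] at e
    have e' := mul_right_cancel₀ hα e
    have : (l : ℂ) + 2 = i + j + k := by rw [e']; ring
    exact_mod_cast this
  have hk1 : 1 ≤ k := by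
    have := hle i₀ j₀ l₀ hi₀ (by omega) hl₀ hlN₀ hne₀
    omega
  right
  -- Shift `1` is possible only for the top brackets, so they are then the only nonzero ones among
  -- `X 2, …, X N`.
  rcases hk1.eq_or_lt with rfl | hk2
  · left
    have hc : c ≠ 0 := by
      rintro rfl
      have := hle i₀ j₀ l₀ hi₀ (by omega) hl₀ hlN₀ hne₀
      rw [h.lie_top i₀ j₀ hi₀ (by omega) (by omega)] at hne₀
      simp at hne₀
    refine hco.isoQ_of_lie_top hfin ?_ h1 hc h.lie_top fun i j hi hij hj hijN => ?_
    · by_contra hodd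
      exact hc (h.odd (Nat.not_even_iff_odd.1 hodd))
    · have hz : ∀ l, 1 ≤ l → l ≤ N → co l ⁅X i, X j⁆ = 0 := by
        intro l hl1 hlN
        by_contra hne
        have e1 := hle i j l hi (by omega) hl1 hlN hne
        have e2 := hl i j l hi (by omega) (by omega) hj hl1 hlN hne
        omega
      rw [hco.eq_smul (m := 1) le_rfl fun l hl1 hlN _ => hz l hl1 hlN,
        hz 1 le_rfl (by omega), zero_smul]
  · right
    have hrec := fun d i hi hd => hco.coord_lie_eq_coefGap (M := N) (k := k) le_rfl
      (fun j hj hjN => h1 j hj hjN.le)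
      (fun j hj hjN => by rw [h1 j (by omega) hjN, h.zero _ (by omega)]) d i hi hd
    refine ⟨k, fun s => co (2 * s + 1 + k) ⁅X (s + 1), X (s + 2)⁆, hk2, by omega, ?_, ?_⟩
    · refine exists_coef_ne_zero (d := j₀ - i₀) (i := i₀) hi₀ (by omega) ?_
      rw [← hrec _ _ hi₀ (by omega)]
      rwa [show 2 * i₀ + (j₀ - i₀) + k - 2 = l₀ by omega, show i₀ + (j₀ - i₀) = j₀ by omega]
    · refine hco.hasTable _ fun i j l hi hij hj hl1 hlN => ?_
      unfold tableA
      rcases hi.eq_or_lt with rfl | hi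
      · rw [if_pos rfl, h1 j (by omega) hj, hco.apply_basis l (j + 1) hl1 hlN (by omega)]
      · rw [if_neg (by omega)]
        split_ifs with hijl
        · have := hrec (j - i) i hi (by omega)
          rw [show 2 * i + (j - i) + k - 2 = l by omega, show i + (j - i) = j by omega] at this
          exact this
        · by_contra hne
          exact hijl (hl i j l hi (by omega) (by omega) hj hl1 hlN hne)

/-- Coefficients below `X N` are governed by a common shift, as in type `L`. A coefficient of `X N`
in a bracket with `i + j ≤ N` instead forces `α = 0`, because the weight of `X N` is tied to `i + j
= N + 1`. A nonzero lower coefficient forces `α ≠ 0`, so both kinds cannot occur together. -/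
theorem IsEigenBasisQ.classify {D : LieDerivation ℂ L L} {α β : ℂ}
    (h : IsEigenBasisQ D N F X α β) (hfin : finrank ℂ L = N) (hN : 5 ≤ N)
    (hαβ : α ≠ 0 ∨ β ≠ 0) : IsoQ L N ∨ (∃ k lam, IsoB L N k lam) ∨
      (α = 0 ∧ β ≠ 0 ∧ ∀ i j, 2 ≤ i → 2 ≤ j → ∃ ω : ℂ, ⁅X i, X j⁆ = ω • X N) := by
  obtain ⟨co, hco⟩ := h.exists_isCoord hfin
  let w : ℕ → ℂ := fun l => if l = 1 then α else if l = N then 2 * β + (N - 3) * α else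
    β + (l - 2) * α
  have hw1 : w 1 = α := rfl
  have hw2 : ∀ l, 2 ≤ l → l < N → w l = β + (l - 2) * α := fun l hl hlN => by
    simp only [w, show l ≠ 1 by omega, hlN.ne, if_false]
  have hwN : w N = 2 * β + (N - 3) * α := by
    simp only [w, show N ≠ 1 by omega, if_false, if_true]
  clear_value w
  have hw : ∀ m, 1 ≤ m → m ≤ N → D (X m) = w m • X m := fun m hm hmN => by
    rcases hm.eq_or_lt with rfl | hm
    · rw [hw1, h.eigen_one]
    · rcases hmN.eq_or_lt with rfl | hmN
      · rw [hwN]; exact h.eigen_top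
      · rw [hw2 m hm hmN]; exact h.eigen m hm hmN
  have hz1 : ∀ j, N - 1 ≤ j → j ≤ N → ⁅X 1, X j⁆ = 0 := fun j hj hjN => by
    rcases hjN.eq_or_lt with rfl | hjN
    · exact h.lie_one_top
    · rw [show j = N - 1 by omega, h.lie_one_last]
  have hle : ∀ i j l, 2 ≤ i → 2 ≤ j → 1 ≤ l → l < N → co l ⁅X i, X j⁆ ≠ 0 → i + j ≤ l := by
    intro i j l hi hj hl hlN hne
    rcases lt_trichotomy (i + j) (N + 1) with hij | hij | hij
    · by_contra hlt
      exact hne (hco.eq_zero_of_mem l (i + j) _ (by omega) (by omega)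
        (h.lie_mem i j hi hj (by omega)))
    · rw [h.lie_top i j hi hj hij, map_smul, hco.apply_basis l N hl hlN.le (by omega),
        if_neg hlN.ne, smul_zero] at hne
      exact absurd rfl hne
    · rw [h.lie_zero i j hi hj (by omega), map_zero] at hne
      exact absurd rfl hne
  have hwt : ∀ i j l, 2 ≤ i → 2 ≤ j → 1 ≤ l → l < N → co l ⁅X i, X j⁆ ≠ 0 →
      β = ((l : ℂ) + 2 - i - j) * α := by
    intro i j l hi hj hl hlN hne
    have := hle i j l hi hj hl hlN hne
    have e := hco.weight_eq D w hw (by omega) (by omega) (by omega) (by omega) hl hlN.le hne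
    rw [hw2 l (by omega) hlN, hw2 i hi (by omega), hw2 j hj (by omega)] at e
    linear_combination -e
  have htop : ∀ i j, 2 ≤ i → 2 ≤ j → i + j ≤ N → co N ⁅X i, X j⁆ ≠ 0 → α = 0 := by
    intro i j hi hj hij hne
    have e := hco.weight_eq D w hw (by omega) (by omega) (by omega) (by omega) (by omega) le_rfl hne
    rw [hwN, hw2 i hi (by omega), hw2 j hj (by omega)] at e
    have e' : ((N : ℂ) + 1 - i - j) * α = 0 := by linear_combination e
    refine (mul_eq_zero.1 e').resolve_left fun h0 => ?_
    have : (N : ℂ) + 1 = i + j := by linear_combination h0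
    have : N + 1 = i + j := by exact_mod_cast this
    omega
  have htable : ∀ k lam, 2 ≤ k → (∀ i j, 2 ≤ i → i < j → i + j ≤ N → co N ⁅X i, X j⁆ = 0) →
      (∀ i j l, 2 ≤ i → i < j → i + j ≤ N → 1 ≤ l → l < N →
        co l ⁅X i, X j⁆ = if l + 2 = i + j + k then coef lam i j else 0) →
      HasTable L N (tableB N k lam) := by
    intro k lam hk hN0 hlow
    refine hco.hasTable _ fun i j l hi hij hj hl1 hlN => ?_
    unfold tableB
    rcases hi.eq_or_lt with rfl | hi
    · rw [if_pos rfl]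
      rcases Nat.lt_or_ge (j + 1) N with hjN | hjN
      · rw [h.lie_one j (by omega) hjN, hco.apply_basis l (j + 1) hl1 hlN (by omega)]
        exact if_congr (by omega) rfl rfl
      · rw [hz1 j (by omega) hj, map_zero, if_neg (by omega)]
    · rw [if_neg (by omega)]
      rcases lt_trichotomy (i + j) (N + 1) with hijN | hijN | hijN
      · rw [if_neg (by omega)]
        rcases hlN.eq_or_lt with rfl | hlN
        · rw [hN0 i j hi hij (by omega), if_neg (by omega)]
        · rw [hlow i j l hi hij (by omega) hl1 hlN]
          exact if_congr (by omega) rfl rfl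
      · rw [h.lie_top i j hi (by omega) hijN, map_smul,
          hco.apply_basis l N hl1 hlN (by omega)]
        by_cases hlN' : l = N
        · simp [hijN, hlN']
        · rw [if_neg hlN', if_neg (by omega), if_neg (by omega), smul_zero]
      · rw [h.lie_zero i j hi (by omega) (by omega), map_zero, if_neg (by omega),
          if_neg (by omega)]
  by_cases hall : ∀ i j l, 2 ≤ i → i < j → i + j ≤ N → 1 ≤ l → l < N → co l ⁅X i, X j⁆ = 0
  · by_cases hallN : ∀ i j, 2 ≤ i → i < j → i + j ≤ N → co N ⁅X i, X j⁆ = 0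
    · left
      refine ⟨h.even, tableQ_of_tableB_zero (k := 2) h.even (by omega)
        (htable 2 _ le_rfl hallN fun i j l hi hij hijN hl1 hlN => ?_)⟩
      rw [hall i j l hi hij hijN hl1 hlN, coef_zero, ite_self]
    · push Not at hallN
      obtain ⟨i₀, j₀, hi₀, hij₀, hijN₀, hne₀⟩ := hallN
      have hα := htop i₀ j₀ hi₀ (by omega) hijN₀ hne₀
      refine Or.inr (Or.inr ⟨hα, hαβ.resolve_left (not_not.2 hα), ?_⟩)
      have hlt : ∀ i j, 2 ≤ i → i < j → ∃ ω : ℂ, ⁅X i, X j⁆ = ω • X N := by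
        intro i j hi hij
        rcases lt_trichotomy (i + j) (N + 1) with hijN | hijN | hijN
        · exact ⟨_, hco.eq_smul (by omega) fun l hl1 hlN hlN' =>
            hall i j l hi hij (by omega) hl1 (by omega)⟩
        · exact ⟨_, h.lie_top i j hi (by omega) hijN⟩
        · exact ⟨0, by rw [h.lie_zero i j hi (by omega) (by omega), zero_smul]⟩
      intro i j hi hj
      rcases lt_trichotomy i j with hij | rfl | hij
      · exact hlt i j hi hij
      · exact ⟨0, by rw [lie_self, zero_smul]⟩
      · obtain ⟨ω, hω⟩ := hlt j i hj hij
        exact ⟨-ω, by rw [← lie_skew, hω, neg_smul]⟩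
  · right; left
    push Not at hall
    obtain ⟨i₀, j₀, l₀, hi₀, hij₀, hijN₀, hl₀, hlN₀, hne₀⟩ := hall
    have hle₀ := hle i₀ j₀ l₀ hi₀ (by omega) hl₀ hlN₀ hne₀
    obtain ⟨k, hk⟩ : ∃ k, l₀ + 2 = i₀ + j₀ + k := ⟨l₀ + 2 - i₀ - j₀, by omega⟩
    have hβ : β = k * α := by
      rw [hwt i₀ j₀ l₀ hi₀ (by omega) hl₀ hlN₀ hne₀]
      have : (l₀ : ℂ) + 2 = i₀ + j₀ + k := by exact_mod_cast hk
      rw [this]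
      ring
    have hα : α ≠ 0 := by
      rintro rfl
      rw [mul_zero] at hβ
      simp [hβ] at hαβ
    have hrec := fun d i hi hd => hco.coord_lie_eq_coefGap (M := N - 1) (k := k) (by omega)
      (fun j hj hjN => h.lie_one j hj (by omega)) hz1 d i hi hd
    refine ⟨k, fun s => co (2 * s + 1 + k) ⁅X (s + 1), X (s + 2)⁆, h.even, by omega, by omega,
      ?_, ?_⟩
    · refine exists_coef_ne_zero (d := j₀ - i₀) (i := i₀) hi₀ (by omega) ?_
      rw [← hrec _ _ hi₀ (by omega)]
      rwa [show 2 * i₀ + (j₀ - i₀) + k - 2 = l₀ by omega, show i₀ + (j₀ - i₀) = j₀ by omega]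
    · refine htable k _ (by omega) (fun i j hi hij hijN => ?_) fun i j l hi hij hijN hl1 hlN => ?_
      · by_contra hne
        exact hα (htop i j hi (by omega) hijN hne)
      · split_ifs with hijl
        · have := hrec (j - i) i hi (by omega)
          rw [show 2 * i + (j - i) + k - 2 = l by omega, show i + (j - i) = j by omega] at this
          exact this
        · by_contra hne
          have e := hwt i j l hi (by omega) hl1 hlN hne
          rw [hβ] at e
          have e' := mul_right_cancel₀ hα e
          have : (l : ℂ) + 2 = i + j + k := by rw [e']; ring
          exact hijl (by exact_mod_cast this)

end Classification

/-! ### Exclusion of the exceptional case -/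

section Completable

variable {L : Type*} [LieRing L] [LieAlgebra ℂ L]

theorem IsAdapted.isoL_of_le_four {N : ℕ} {F : ℕ → Submodule ℂ L} {y : ℕ → L}
    (h : IsAdapted N F y) (hfin : finrank ℂ L = N) (hN : N ≤ 4) : IsoL L N := by
  obtain ⟨co, hco⟩ := h.exists_isCoord hfin
  refine hco.isoL (fun j hj _ => h.lie_one j hj) fun i j l hi hij hj _ _ => ?_
  have h0 : ⁅y i, y j⁆ = 0 := by
    rcases Nat.lt_or_ge (i + j) (N + 2) with hij' | hij'
    · obtain ⟨rfl, rfl, rfl⟩ : i = 2 ∧ j = 3 ∧ N = 4 := by omega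
      have := h.lie_two_three
      rwa [h.bot 5 (by omega), Submodule.mem_bot] at this
    · exact h.lie_eq_zero hi (by omega) hij' (h.mem (by omega)) (h.mem (by omega))
  rw [h0, map_zero]

/-- With a zero torus, the nonzero center of the nilpotent algebra would be central in the
semidirect product. -/
theorem exists_ne_zero_of_isCompleteLie [Nontrivial L] (hnil : LieRing.IsNilpotent L)
    {t : LieSubalgebra ℂ (LieDerivation ℂ L L)} (h : IsCompleteLie (L ⋊⁅t.incl⁆ t)) :
    ∃ D ∈ t, D ≠ 0 := by
  by_contra! h0
  have hs : ∀ s : t, s = 0 := fun s => Subtype.ext (h0 s s.2)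
  have := non_trivial_center_of_isNilpotent (R := ℂ) (L := L)
  obtain ⟨⟨z, hz⟩, hz0⟩ := exists_ne (0 : center ℂ L)
  rw [LieModule.mem_maxTrivSubmodule] at hz
  have hmem : (⟨z, 0⟩ : L ⋊⁅t.incl⁆ t) ∈ center ℂ (L ⋊⁅t.incl⁆ t) := by
    rw [LieModule.mem_maxTrivSubmodule]
    rintro ⟨x, s⟩
    rw [hs s]
    simp [hz x]
  rw [h.1, LieSubmodule.mem_bot] at hmem
  exact hz0 (Subtype.ext (congrArg SemiDirectSum.left hmem))

variable {N : ℕ} {F : ℕ → Submodule ℂ L} {X : ℕ → L} {D : LieDerivation ℂ L L} {α β c : ℂ}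

theorem IsFlagBasis.derivation_eq_zero (h : IsFlagBasis N F X)
    (h0 : ∀ j, 1 ≤ j → j ≤ N → D (X j) = 0) : D = 0 := by
  have : F 1 ≤ LinearMap.ker (D : L →ₗ[ℂ] L) := h.le_of_forall_mem _ le_rfl h0
  rw [h.top] at this
  ext x
  exact this trivial

theorem IsEigenBasisL.weight_ne_zero (h : IsEigenBasisL D N F X α β c) (hD : D ≠ 0) :
    α ≠ 0 ∨ β ≠ 0 := by
  by_contra! h0
  obtain ⟨rfl, rfl⟩ := h0
  refine hD (h.derivation_eq_zero fun j hj hjN => ?_)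
  rcases hj.eq_or_lt with rfl | hj
  · rw [h.eigen_one, zero_smul]
  · rcases hjN.eq_or_lt with rfl | hjN
    · rw [h.eigen_top]; simp
    · rw [h.eigen j hj hjN]; simp

theorem IsEigenBasisQ.weight_ne_zero (h : IsEigenBasisQ D N F X α β) (hD : D ≠ 0) :
    α ≠ 0 ∨ β ≠ 0 := by
  by_contra! h0
  obtain ⟨rfl, rfl⟩ := h0
  refine hD (h.derivation_eq_zero fun j hj hjN => ?_)
  rcases hj.eq_or_lt with rfl | hj
  · rw [h.eigen_one, zero_smul]
  · rcases hjN.eq_or_lt with rfl | hjN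
    · rw [h.eigen_top]; simp
    · rw [h.eigen j hj hjN]; simp

/-- If all brackets of `X 2, …, X N` are multiples of `X N`, the cube of `ad (X 1)` on
`X 2, …, X (N - 1)` extends to a derivation. -/
theorem IsEigenBasisQ.exists_derivation (h : IsEigenBasisQ D N F X 0 β) (hfin : finrank ℂ L = N)
    (hN : 6 ≤ N) (hω : ∀ i j, 2 ≤ i → 2 ≤ j → ∃ ω : ℂ, ⁅X i, X j⁆ = ω • X N) :
    ∃ δ : LieDerivation ℂ L L, δ (X 2) = X 5 ∧ δ (X N) = 0 ∧ ∀ x, δ (D x) = D (δ x) := by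
  obtain ⟨b, hb⟩ := h.exists_basis hfin
  -- Replacing `X N` by `0` makes `ad (X 1)` a uniform shift of `v`, because it kills `X (N - 1)`.
  let v : ℕ → L := fun j => if j < N then X j else 0
  have hv : ∀ j, j < N → v j = X j := fun j hj => if_pos hj
  have hv0 : ∀ j, N ≤ j → v j = 0 := fun j hj => if_neg (by omega)
  clear_value v
  let f : L →ₗ[ℂ] L := b.constr ℂ fun i => if (i : ℕ) = 0 then 0 else v (i + 4)
  have hf : ∀ i : Fin N, f (b i) = if (i : ℕ) = 0 then 0 else v (i + 4) := fun i =>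
    b.constr_basis ℂ _ i
  have hf1 : f (X 1) = 0 := by
    have := hf ⟨0, by omega⟩
    rwa [if_pos rfl, hb] at this
  have hfj : ∀ j, 2 ≤ j → j ≤ N → f (X j) = v (j + 3) := fun j hj hjN => by
    have := hf ⟨j - 1, by omega⟩
    simp only [hb, show j - 1 ≠ 0 by omega, if_false] at this
    rwa [Nat.sub_add_cancel (by omega), show j - 1 + 4 = j + 3 by omega] at this
  clear_value f
  have hfv : ∀ j, 2 ≤ j → f (v j) = v (j + 3) := fun j hj => by
    rcases Nat.lt_or_ge j N with hjN | hjN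
    · rw [hv j hjN, hfj j hj hjN.le]
    · rw [hv0 j hjN, hv0 (j + 3) (by omega), map_zero]
  have h1v : ∀ j, 2 ≤ j → ⁅X 1, v j⁆ = v (j + 1) := fun j hj => by
    rcases lt_trichotomy (j + 1) N with hjN | hjN | hjN
    · rw [hv j (by omega), hv (j + 1) hjN, h.lie_one j hj hjN]
    · rw [hv j (by omega), hv0 (j + 1) (by omega), show j = N - 1 by omega, h.lie_one_last]
    · rw [hv0 j (by omega), hv0 (j + 1) (by omega), lie_zero]
  have hvω : ∀ i j, 2 ≤ i → 2 ≤ j → ∃ ω : ℂ, ⁅v i, v j⁆ = ω • X N := fun i j hi hj => by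
    rcases Nat.lt_or_ge i N with hiN | hiN
    · rcases Nat.lt_or_ge j N with hjN | hjN
      · rw [hv i hiN, hv j hjN]; exact hω i j hi hj
      · exact ⟨0, by rw [hv0 j hjN, lie_zero, zero_smul]⟩
    · exact ⟨0, by rw [hv0 i hiN, zero_lie, zero_smul]⟩
  -- Brackets of the `v j` are multiples of `X N`, which `X 1` kills, so `ad (X 1)` is skew for
  -- them. So is its cube, the first odd power after the inner derivation `ad (X 1)` itself.
  have hskew : ∀ i j, 2 ≤ i → 2 ≤ j → ⁅v (i + 1), v j⁆ = -⁅v i, v (j + 1)⁆ := fun i j hi hj => by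
    obtain ⟨ω, h0⟩ := hvω i j hi hj
    have e : ⁅X 1, ⁅v i, v j⁆⁆ = 0 := by rw [h0, lie_smul, h.lie_one_top, smul_zero]
    rw [leibniz_lie, h1v i hi, h1v j hj] at e
    exact eq_neg_of_add_eq_zero_left e
  have hvN : ∀ i, 2 ≤ i → ⁅v i, X N⁆ = 0 := fun i hi => by
    rcases Nat.lt_or_ge i N with hiN | hiN
    · rw [hv i hiN, h.lie_zero i N hi (by omega) (by omega)]
    · rw [hv0 i hiN, zero_lie]
  have hleib : ∀ i j : Fin N, i < j → f ⁅b i, b j⁆ = ⁅f (b i), b j⁆ + ⁅b i, f (b j)⁆ := by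
    intro i j hij
    have hij : (i : ℕ) < j := hij
    rw [hb, hb]
    have hjN : (j : ℕ) + 1 ≤ N := by omega
    generalize hi' : (i : ℕ) + 1 = i'
    generalize hj' : (j : ℕ) + 1 = j' at hjN
    rcases Nat.eq_zero_or_pos (i : ℕ) with hi0 | hi0
    · obtain rfl : i' = 1 := by omega
      rw [hf1, zero_lie, zero_add, hfj j' (by omega) hjN, h1v (j' + 3) (by omega)]
      rcases hjN.eq_or_lt with rfl | hjN
      · rw [h.lie_one_top, map_zero, hv0 _ (by omega)]
      · rw [← hv j' hjN, h1v j' (by omega), hfv (j' + 1) (by omega)]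
    · have hω' := hω i' j' (by omega) (by omega)
      obtain ⟨ω, h0⟩ := hω'
      rw [h0, map_smul, hfj N (by omega) le_rfl, hv0 _ (by omega), smul_zero,
        hfj i' (by omega) (by omega), hfj j' (by omega) hjN]
      rcases hjN.eq_or_lt with rfl | hjN
      · rw [hvN _ (by omega), hv0 _ (by omega), lie_zero, add_zero]
      · rw [← hv i' (by omega), ← hv j' hjN, hskew (i' + 2) j' (by omega) (by omega),
          hskew (i' + 1) (j' + 1) (by omega) (by omega),
          hskew i' (j' + 2) (by omega) (by omega), neg_neg]
        exact (neg_add_cancel _).symm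
  have hDv : ∀ j, 2 ≤ j → D (v j) = β • v j := fun j hj => by
    rcases Nat.lt_or_ge j N with hjN | hjN
    · rw [hv j hjN, h.eigen j hj hjN, mul_zero, add_zero]
    · rw [hv0 j hjN, map_zero, smul_zero]
  have hcomm : f.comp (D : L →ₗ[ℂ] L) = (D : L →ₗ[ℂ] L).comp f := by
    obtain ⟨co, hco⟩ := h.exists_isCoord hfin
    refine hco.linearMap_ext fun m hm hmN => ?_
    simp only [LinearMap.comp_apply, LieDerivation.coeFn_coe]
    rcases hm.eq_or_lt with rfl | hm
    · rw [h.eigen_one, hf1, zero_smul, map_zero, map_zero]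
    · rcases hmN.eq_or_lt with rfl | hmN
      · rw [h.eigen_top, map_smul, hfj m hm le_rfl, hv0 _ (by omega), smul_zero, map_zero]
      · rw [← hv m hmN, hDv m hm, map_smul, hfv m hm, hDv (m + 3) (by omega)]
  refine ⟨derivationOfBasis b f hleib, ?_, ?_, fun x => LinearMap.congr_fun hcomm x⟩
  · change f (X 2) = X 5
    rw [hfj 2 le_rfl (by omega), hv 5 (by omega)]
  · change f (X N) = 0
    rw [hfj N (by omega) le_rfl, hv0 _ (by omega)]

/-- A derivation commuting with the torus `t` extends to `L ⋊ t`, by zero on `t`. -/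
def extendDerivation {t : LieSubalgebra ℂ (LieDerivation ℂ L L)} (δ : LieDerivation ℂ L L)
    (hδ : ∀ s ∈ t, ∀ x, δ (s x) = s (δ x)) : LieDerivation ℂ (L ⋊⁅t.incl⁆ t) (L ⋊⁅t.incl⁆ t) where
  toFun z := ⟨δ z.left, 0⟩
  map_add' a b := by simp
  map_smul' r a := by simp
  leibniz' a b := by
    have h1 := hδ a.right a.right.2 b.left
    have h2 := hδ b.right b.right.2 a.left
    refine SemiDirectSum.ext ?_ ?_
    · change δ (⁅a.left, b.left⁆ + (a.right : LieDerivation ℂ L L) b.left -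
          (b.right : LieDerivation ℂ L L) a.left) =
        ⁅a.left, δ b.left⁆ + (a.right : LieDerivation ℂ L L) (δ b.left) -
          (0 : LieDerivation ℂ L L) a.left -
        (⁅b.left, δ a.left⁆ + (b.right : LieDerivation ℂ L L) (δ a.left) -
          (0 : LieDerivation ℂ L L) b.left)
      rw [map_sub, map_add, h1, h2, δ.apply_lie_eq_sub, LieDerivation.zero_apply,
        LieDerivation.zero_apply]
      abel
    · simp

/-- If the torus is spanned by a derivation with an eigenbasis of type `Q` and weight `0` on the
first vector, all brackets of the other vectors being in the center, the Lie algebra `L ⋊ t` has an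
outer derivation. -/
theorem IsEigenBasisQ.not_isCompleteLie (h : IsEigenBasisQ D N F X 0 β) (hfin : finrank ℂ L = N)
    (hN : 6 ≤ N) (hβ : β ≠ 0) (hω : ∀ i j, 2 ≤ i → 2 ≤ j → ∃ ω : ℂ, ⁅X i, X j⁆ = ω • X N)
    {t : LieSubalgebra ℂ (LieDerivation ℂ L L)} (ht : ∀ s ∈ t, ∃ c : ℂ, s = c • D) :
    ¬ IsCompleteLie (L ⋊⁅t.incl⁆ t) := by
  intro hcomp
  obtain ⟨δ, hδ2, hδN, hδD⟩ := h.exists_derivation hfin hN hω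
  have hδt : ∀ s ∈ t, ∀ x, δ (s x) = s (δ x) := fun s hs x => by
    obtain ⟨c, rfl⟩ := ht s hs
    rw [LieDerivation.smul_apply, LieDerivation.smul_apply, map_smul, hδD]
  obtain ⟨⟨p, s⟩, hps⟩ := hcomp.2 (extendDerivation δ hδt)
  have hp : ∀ x, δ x = ⁅p, x⁆ + (s : LieDerivation ℂ L L) x := fun x => by
    have := congrArg SemiDirectSum.left (hps ⟨x, 0⟩)
    simpa [extendDerivation] using this
  obtain ⟨c, hc⟩ := ht s s.2
  obtain ⟨a, ha⟩ := h.exists_sub_mem le_rfl (show p ∈ F 1 by rw [h.top]; trivial)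
  have hpj : ∀ j, 2 ≤ j → ⁅p, X j⁆ - a • ⁅X 1, X j⁆ ∈ F N := fun j hj => by
    have hle : F 2 ≤ (F N).comap (ad ℂ L (X j) : L →ₗ[ℂ] L) :=
      h.le_of_forall_mem _ (by omega) fun i hi _ => by
        obtain ⟨ω, h0⟩ := hω j i hj hi
        rw [Submodule.mem_comap, ad_apply, h0]
        exact (F N).smul_mem _ (h.mem (by omega))
    have := hle ha
    rw [Submodule.mem_comap, ad_apply, ← lie_skew, sub_lie, smul_lie] at this
    exact (neg_mem_iff).1 this
  have hpN : ⁅p, X N⁆ = 0 := by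
    have hle : F 2 ≤ LinearMap.ker (ad ℂ L (X N) : L →ₗ[ℂ] L) :=
      h.le_of_forall_mem _ (by omega) fun i hi _ => by
        rw [LinearMap.mem_ker, ad_apply, h.lie_zero N i (by omega) hi (by omega)]
    have := hle ha
    rw [LinearMap.mem_ker, ad_apply, ← lie_skew, sub_lie, smul_lie, h.lie_one_top,
      neg_eq_zero, smul_zero, sub_zero] at this
    exact this
  -- Evaluating on `X N`, where `δ` and `ad p` vanish and `D` acts by `2β ≠ 0`, removes the torus
  -- part.
  have hc0 : c = 0 := by
    have e := hp (X N)
    rw [hδN, hpN, hc, LieDerivation.smul_apply, h.eigen_top, zero_add, smul_smul, eq_comm,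
      smul_eq_zero, or_iff_left (h.ne_zero (by omega) le_rfl)] at e
    simpa [hβ] using e
  have e := hp (X 2)
  rw [hδ2, hc, hc0, zero_smul, LieDerivation.zero_apply, add_zero] at e
  have e2 := hpj 2 le_rfl
  rw [← e, h.lie_one 2 le_rfl (by omega)] at e2
  -- On `X 2` the identity now reads `X 5 = a • X 3` modulo `F N`. Since `N ≥ 6`, this gives `a = 0`
  -- and then `X 5 ∈ F 6`, which is absurd.
  have ha0 : a = 0 := by
    have m1 := sub_mem (h.mem_of_le (i := 4) (j := 5) (by omega) (by omega))
      (h.antitone (i := 4) (by omega) (by omega) e2)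
    rw [sub_sub_cancel] at m1
    exact h.eq_zero (by omega) (by omega) m1
  rw [ha0, zero_smul, sub_zero] at e2
  exact h.notMem 5 (by omega) (by omega) (h.antitone (by omega) hN e2)

theorem families_of_isCompletable [FiniteDimensional ℂ L] (hfil : IsFiliform L)
    (h : IsCompletable L) : (∃ N : ℕ, IsoL L N) ∨ (∃ N : ℕ, IsoQ L N) ∨
      (∃ (N k : ℕ) (lam : ℕ → ℂ), IsoA L N k lam) ∨
      (∃ (N k : ℕ) (lam : ℕ → ℂ), IsoB L N k lam) := by
  by_contra hno
  have h2 := hfil.two_le_finrank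
  rcases h2.eq_or_lt with h2 | h3
  · exact hno (Or.inl ⟨_, hfil.isoL_of_finrank_eq_two h2.symm⟩)
  obtain ⟨F, y, hy⟩ := hfil.exists_adapted h3
  rcases Nat.lt_or_ge (finrank ℂ L) 5 with h4 | h5
  · exact hno (Or.inl ⟨_, hy.isoL_of_le_four rfl (by omega)⟩)
  obtain ⟨t, ht, hcomp⟩ := h
  -- Outside the families every nonzero element of the torus is exceptional, with an eigenbasis
  -- adapted to the same flag `F`.
  have key : ∀ D ∈ t, D ≠ 0 → ∃ X β, IsEigenBasisQ D (finrank ℂ L) F X 0 β ∧ β ≠ 0 ∧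
      ∀ i j, 2 ≤ i → 2 ≤ j → ∃ ω : ℂ, ⁅X i, X j⁆ = ω • X (finrank ℂ L) := by
    intro D hD hD0
    rcases hy.exists_eigenbasis h5 D (ht.1.2 D hD) with ⟨X, α, β, c, hX⟩ | ⟨X, α, β, hX⟩
    · rcases hX.classify rfl h5 (hX.weight_ne_zero hD0) with hL | hQ | ⟨k, lam, hA⟩
      · exact absurd (Or.inl ⟨_, hL⟩) hno
      · exact absurd (Or.inr (Or.inl ⟨_, hQ⟩)) hno
      · exact absurd (Or.inr (Or.inr (Or.inl ⟨_, k, lam, hA⟩))) hno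
    · rcases hX.classify rfl h5 (hX.weight_ne_zero hD0) with hQ | ⟨k, lam, hB⟩ | ⟨rfl, hβ, hω⟩
      · exact absurd (Or.inr (Or.inl ⟨_, hQ⟩)) hno
      · exact absurd (Or.inr (Or.inr (Or.inr ⟨_, k, lam, hB⟩))) hno
      · exact ⟨X, β, hX, hβ, hω⟩
  have : Nontrivial L := Module.nontrivial_of_finrank_pos (R := ℂ) (by omega)
  obtain ⟨D, hD, hD0⟩ := exists_ne_zero_of_isCompleteLie hfil.1 hcomp
  obtain ⟨X, β, hX, hβ, hω⟩ := key D hD hD0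
  have h6 : 6 ≤ finrank ℂ L := by
    obtain ⟨r, hr⟩ := hX.even
    omega
  have hFN : ∀ x ∈ F (finrank ℂ L), ∃ a : ℂ, x = a • X (finrank ℂ L) := fun x hx => by
    obtain ⟨a, ha⟩ := hX.exists_sub_mem (by omega) hx
    rw [hX.bot _ (by omega), Submodule.mem_bot] at ha
    exact ⟨a, sub_eq_zero.1 ha⟩
  refine hX.not_isCompleteLie rfl h6 hβ hω (fun s hs => ?_) hcomp
  obtain ⟨a, ha⟩ := hFN (s (X (finrank ℂ L)))
    (hy.derivation_mem h5 s (by omega) (hX.mem (by omega)))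
  -- This multiple of `D` agrees with `s` on `X N`. If their difference were nonzero, it would be
  -- exceptional too and act on the line `F N` by some `2β' ≠ 0`, yet it vanishes there.
  refine ⟨a / (2 * β), ?_⟩
  by_contra hne
  have hmem : s - (a / (2 * β)) • D ∈ t := sub_mem hs (t.smul_mem _ hD)
  obtain ⟨X', β', hX', hβ', -⟩ := key _ hmem (sub_ne_zero.2 hne)
  obtain ⟨r, hr⟩ := hFN _ (hX'.mem (by omega))
  have e := hX'.eigen_top
  have e0 : (s - (a / (2 * β)) • D) (X (finrank ℂ L)) = 0 := by
    rw [LieDerivation.sub_apply, LieDerivation.smul_apply, ha, hX.eigen_top, mul_zero, add_zero,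
      smul_smul, div_mul_cancel₀ _ (by simpa using hβ), sub_self]
  rw [hr, map_smul, e0, smul_zero, ← hr, mul_zero, add_zero, eq_comm, smul_eq_zero,
    or_iff_left (hX'.ne_zero (by omega) le_rfl)] at e
  simp [hβ'] at e

end Completable

end CompletableFiliform

theorem mainTheorem1 (n : Type*) [LieRing n] [LieAlgebra ℂ n] [FiniteDimensional ℂ n]
    (hfil : CompletableFiliform.IsFiliform n) (hrank : CompletableFiliform.rank n ≠ 0) :
    CompletableFiliform.IsCompletable n ↔
      (∃ N : ℕ, CompletableFiliform.IsoL n N) ∨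
      (∃ N : ℕ, CompletableFiliform.IsoQ n N) ∨
      (∃ (N k : ℕ) (lam : ℕ → ℂ), CompletableFiliform.IsoA n N k lam) ∨
      (∃ (N k : ℕ) (lam : ℕ → ℂ), CompletableFiliform.IsoB n N k lam) :=
  ⟨CompletableFiliform.families_of_isCompletable hfil,
    CompletableFiliform.isCompletable_of_families⟩
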